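/- **Notation.** For $\tau\in\mathbb C$ with $\operatorname{Im}\tau>0$ and $x\in\mathbb R$ put $q^x:=e^{2\pi i x\tau}$. For $z,z_1,z_2,t\in\mathbb C$ let $$\theta_{k,m}(\tau,z):=\sum_{j\in\mathbb Z}e^{2\pi i m(j+\frac{k}{2m})z}q^{m(j+\frac{k}{2m})^2},\qquad \theta^{(-)}_{k,m}(\tau,z):=\sum_{j\in\mathbb Z}(-1)^j e^{2\pi i m(j+\frac{k}{2m})z}q^{m(j+\frac{k}{2m})^2},$$ $$\vartheta_{11}(\tau,z):=\sum_{n\in\mathbb Z}e^{\pi i (n+\frac12)^2\tau+2\pi i(n+\frac12)(z+\frac12)},\qquad \eta(\tau):=q^{\frac1{24}}\prod_{n=1}^\infty(1-q^n),$$ $$\Phi^{[m,s]}(\tau,z_1,z_2,t):=e^{-2\pi i m t}\left(\sum_{j\in\mathbb Z}\frac{e^{2\pi i mj(z_1+z_2)+2\pi i s z_1}q^{mj^2+sj}}{1-e^{2\pi i z_1}q^j}-\sum_{j\in\mathbb Z}\frac{e^{-2\pi i mj(z_1+z_2)-2\pi i s z_2}q^{mj^2+sj}}{1-e^{-2\pi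 i z_2}q^j}\right).$$ (When the first argument is $2\tau$, $q$ is replaced by $q^2$ in these definitions.) **Proposition.** Let $m\in\frac12\mathbb N_{\rm odd}$, i.e. $2m$ is an odd positive integer, let $\operatorname{Im}\tau>0$, and let $z_1,z_2\in\mathbb C$ with $2z_1,2z_2\notin\mathbb Z+2\tau\mathbb Z$. Then the infinite sums over $j$ below converge absolutely (the inner sums over $r,k$ being finite), and $$\begin{aligned} &\theta^{(-)}_{-2m,2m+1}\Big(\tau,\tfrac{2m(z_1-z_2)}{2m+1}\Big)\,\Phi^{[m,0]}(2\tau,2z_1,2z_2,0)\\ &=-i\,\eta(2\tau)^3\left\{\frac{\theta^{(-)}_{2m,2m+1}\big(\tau,\frac{z_1-z_2}{2m+1}+z_1+z_2\big)}{\vartheta_{11}(2\tau,2z_1)}+\frac{\theta^{(-)}_{2m,2m+1}\big(\tau,\frac{z_1-z_2}{2m+1}-z_1-z_2\big)}{\vartheta_{11}(2\tau,2z_2)}\right\}\\ &\quad-q^{-\frac{m}{2(2m+1)}}e^{\frac{2\pi i m}{2m+1}(z_1-z_2)}\sum_{j=1}^\infty\sum_{r=1}^{j}\sum_{\substack{0\le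 k\le 2m-1\\ k\ \mathrm{even}}}(-1)^jq^{(2m+1)j^2-\frac1{8m}(4m(j-r)+2m-k)^2}\\ &\qquad\times\Big\{e^{\pi i(4mr-2m+k)(z_1-z_2)}q^{-\frac12(4mr-2m+k)}+e^{-\pi i(4mr-2m+k)(z_1-z_2)}q^{\frac12(4mr-2m+k)}\Big\}\big[\theta_{k,2m}-\theta_{-k,2m}\big](\tau,z_1+z_2)\\ &\quad+q^{-\frac{m}{2(2m+1)}}e^{\frac{2\pi i m}{2m+1}(z_1-z_2)}\sum_{j=1}^\infty\sum_{r=0}^{j-1}\sum_{\substack{0\le k\le 2m-1\\ k\ \mathrm{even}}}(-1)^jq^{(2m+1)j^2-\frac1{8m}(4m(j-r)-2m+k)^2}\\ &\qquad\times\Big\{e^{\pi i(4mr+2m-k)(z_1-z_2)}q^{-\frac12(4mr+2m-k)}+e^{-\pi i(4mr+2m-k)(z_1-z_2)}q^{\frac12(4mr+2m-k)}\Big\}\big[\theta_{k,2m}-\theta_{-k,2m}\big](\tau,z_1+z_2)\\ &\quad+\theta^{(-)}_{-2m,2m+1}\Big(\tau,\tfrac{2m(z_1-z_2)}{2m+1}\Big)\sum_{k=1}^{m-\frac12}e^{2\pi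 i k(z_1-z_2)}q^{-\frac{k^2}{2m}}\big[\theta_{k,m}-\theta_{-k,m}\big](2\tau,2z_1+2z_2). \end{aligned}$$ -/

import Mathlib

open scoped Real
open Complex (I)

noncomputable section

namespace MockTheta

/-- The power `q ^ x` of the nome, i.e. `exp (2 π i x τ)`, where `q = exp (2 π i τ)`. -/
def qPow (τ : ℂ) (x : ℝ) : ℂ :=
  Complex.exp (2 * π * I * (x : ℂ) * τ)

/-- Jacobi's theta function of degree `m` and index `k`. -/
def theta (k m : ℝ) (τ z : ℂ) : ℂ :=
  ∑' j : ℤ, Complex.exp (2 * π * I * (m : ℂ) * ((j : ℂ) + (k : ℂ) / (2 * (m : ℂ))) * z) *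
    qPow τ (m * ((j : ℝ) + k / (2 * m)) ^ 2)

/-- The signed theta function `θ⁽⁻⁾` of degree `m` and index `k`. -/
def thetaMinus (k m : ℝ) (τ z : ℂ) : ℂ :=
  ∑' j : ℤ, (-1 : ℂ) ^ j *
    Complex.exp (2 * π * I * (m : ℂ) * ((j : ℂ) + (k : ℂ) / (2 * (m : ℂ))) * z) *
    qPow τ (m * ((j : ℝ) + k / (2 * m)) ^ 2)

/-- Mumford's theta function with characteristic `(1, 1)`. -/
def vartheta11 (τ z : ℂ) : ℂ :=
  ∑' n : ℤ, Complex.exp (π * I * ((n : ℂ) + 1 / 2) ^ 2 * τ +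
    2 * π * I * ((n : ℂ) + 1 / 2) * (z + 1 / 2))

/-- The first component of the mock theta function `Φ^[m,s]`. -/
def Phi1 (m s : ℝ) (τ z₁ z₂ t : ℂ) : ℂ :=
  Complex.exp (-2 * π * I * (m : ℂ) * t) *
    ∑' j : ℤ,
      Complex.exp (2 * π * I * (m : ℂ) * (j : ℂ) * (z₁ + z₂) + 2 * π * I * (s : ℂ) * z₁) *
          qPow τ (m * (j : ℝ) ^ 2 + s * (j : ℝ)) /
        (1 - Complex.exp (2 * π * I * z₁) * qPow τ (j : ℝ))

/-- The second component of the mock theta function `Φ^[m,s]`. -/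
def Phi2 (m s : ℝ) (τ z₁ z₂ t : ℂ) : ℂ :=
  Complex.exp (-2 * π * I * (m : ℂ) * t) *
    ∑' j : ℤ,
      Complex.exp (-2 * π * I * (m : ℂ) * (j : ℂ) * (z₁ + z₂) - 2 * π * I * (s : ℂ) * z₂) *
          qPow τ (m * (j : ℝ) ^ 2 + s * (j : ℝ)) /
        (1 - Complex.exp (-2 * π * I * z₂) * qPow τ (j : ℝ))

/-- The mock theta function `Φ^[m,s]`. -/
def Phi (m s : ℝ) (τ z₁ z₂ t : ℂ) : ℂ :=
  Phi1 m s τ z₁ z₂ t - Phi2 m s τ z₁ z₂ t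

end MockTheta

end

/-! Write `N = 2m = 2h+1`, `v = z₁ - z₂`, `u = z₁ + z₂`. Up to one elementary factor the left side
is `T(v) (A(v,u) - A(v,-u))`, with `T` a signed theta series and `A` an Appell sum whose n-th
summand has denominator `1 - Y`, `Y = q^(2n) e^(2πi(v+u))`. The ϑ₁₁-quotients have the same poles:
the partial fraction series of `-iη(2τ)³/ϑ₁₁(2τ, v+u)` has the same denominators. This expansion
(`vartheta11_mul_tsum`) is proved by computing Laurent coefficients and rests on Jacobi's series for
the cube of the Euler product (`tsum_jacobiCoeff`).

Subtracting the quotient from `T A` leaves `(1 - Y^a)/(1 - Y)` in each summand, a finite geometric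
sum with no pole (`thetaT_mul_appell_sub`). The result is an indefinite theta series over ℤ³,
restricted to a cone on which its quadratic form is positive up to lower order terms
(`quadratic_lower_bound`).

Grouping by the exponent `L` of `e^(2πiu)` and completing the square gives `∑ c(L) q^(L²/N)
e^(2πiLu)`. The coefficients `c(L)` are N-periodic: a shift of `L` by `N` changes `c` by a boundary
sum, which a sign-reversing involution kills (`tsum_ite_coeffTerm`). Hence antisymmetrizing in `u`
produces the differences of theta functions of opposite index, for `1 ≤ k ≤ h`
(`tsum_tripleTerm_sub`).

For `|k| ≤ h`, `c(k)` is a sum over two lattice sectors, plus the line `r = 0` when `k ≥ 0`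
(`sgnInd_of_nonneg`, `sgnInd_of_neg`). The line gives the last sum of the proposition, the sectors
the two double sums. -/

noncomputable section

namespace MockTheta

/-! ### Exponentials and Gaussian majorants -/

/-- The exponential `exp (2 π i (x τ + y v + w u))` with real exponents. -/
def expo (τ v u : ℂ) (x y w : ℝ) : ℂ :=
  Complex.exp (2 * π * I * ((x : ℂ) * τ + (y : ℂ) * v + (w : ℂ) * u))

section expo

variable (τ v u : ℂ)

lemma expo_add (x y w x' y' w' : ℝ) :
    expo τ v u (x + x') (y + y') (w + w') = expo τ v u x y w * expo τ v u x' y' w' := by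
  simp only [expo, ← Complex.exp_add]
  congr 1
  push_cast
  ring

lemma expo_mul_eq {x y w x' y' w' x'' y'' w'' : ℝ} (hx : x + x' = x'') (hy : y + y' = y'')
    (hw : w + w' = w'') :
    expo τ v u x y w * expo τ v u x' y' w' = expo τ v u x'' y'' w'' := by
  rw [← hx, ← hy, ← hw, expo_add]

lemma expo_zero : expo τ v u 0 0 0 = 1 := by simp [expo]

lemma expo_ne_zero (x y w : ℝ) : expo τ v u x y w ≠ 0 := Complex.exp_ne_zero _

lemma expo_zpow (x y w : ℝ) (n : ℤ) :
    expo τ v u x y w ^ n = expo τ v u (n * x) (n * y) (n * w) := by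
  simp only [expo, ← Complex.exp_int_mul]
  congr 1
  push_cast
  ring

lemma norm_expo (x y w : ℝ) :
    ‖expo τ v u x y w‖ = Real.exp (-(2 * π * (x * τ.im + y * v.im + w * u.im))) := by
  rw [expo, Complex.norm_exp]
  congr 1
  simp [Complex.mul_re, Complex.mul_im]

end expo

lemma summable_gauss_int {ε : ℝ} (hε : 0 < ε) (c : ℝ) :
    Summable fun n : ℤ => Real.exp (-(ε * (n : ℝ) ^ 2) + c * |(n : ℝ)|) := by
  have h := summable_pow_mul_jacobiTheta₂_term_bound (c / (2 * π)) (T := ε / π)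
    (div_pos hε Real.pi_pos) 0
  refine h.congr fun n => ?_
  rw [pow_zero, one_mul]
  congr 1
  push_cast
  field_simp
  ring

/-- The Gaussian majorant on `ℤ³`. -/
def gauss (ε c : ℝ) (i : ℤ × ℤ × ℤ) : ℝ :=
  Real.exp (c - ε * ((i.1 : ℝ) ^ 2 + (i.2.1 : ℝ) ^ 2 + (i.2.2 : ℝ) ^ 2) +
    c * (|(i.1 : ℝ)| + |(i.2.1 : ℝ)| + |(i.2.2 : ℝ)|))

lemma summable_gauss {ε : ℝ} (hε : 0 < ε) (c : ℝ) : Summable (gauss ε c) := by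
  have h := summable_gauss_int hε c
  have h2 := h.mul_of_nonneg h (fun _ => (Real.exp_pos _).le) fun _ => (Real.exp_pos _).le
  have h3 := h.mul_of_nonneg h2 (fun _ => (Real.exp_pos _).le) fun _ =>
    mul_nonneg (Real.exp_pos _).le (Real.exp_pos _).le
  refine (h3.mul_left (Real.exp c)).congr fun i => ?_
  simp only [gauss, ← Real.exp_add]
  congr 1
  ring

/-- Summability of a family of exponentials whose `q`-exponent dominates a definite form. -/
lemma summable_expo {τ : ℂ} (hτ : 0 < τ.im) (v u : ℂ) {ι : Type*} {φ : ι → ℤ × ℤ × ℤ}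
    (hφ : Function.Injective φ) {f s : ι → ℂ} {X Y W : ι → ℝ}
    (hf : ∀ i, f i = s i * expo τ v u (X i) (Y i) (W i)) {ε c b : ℝ} (hε : 0 < ε)
    (hs : ∀ i, ‖s i‖ ≤ Real.exp (b * (1 + |((φ i).1 : ℝ)| + |((φ i).2.1 : ℝ)| + |((φ i).2.2 : ℝ)|)))
    (hX : ∀ i, s i ≠ 0 → ε * (((φ i).1 : ℝ) ^ 2 + ((φ i).2.1 : ℝ) ^ 2 + ((φ i).2.2 : ℝ) ^ 2) -
      c * (1 + |((φ i).1 : ℝ)| + |((φ i).2.1 : ℝ)| + |((φ i).2.2 : ℝ)|) ≤ X i)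
    (hY : ∀ i, s i ≠ 0 →
      |Y i| ≤ c * (1 + |((φ i).1 : ℝ)| + |((φ i).2.1 : ℝ)| + |((φ i).2.2 : ℝ)|))
    (hW : ∀ i, s i ≠ 0 →
      |W i| ≤ c * (1 + |((φ i).1 : ℝ)| + |((φ i).2.1 : ℝ)| + |((φ i).2.2 : ℝ)|)) :
    Summable f := by
  set C : ℝ := b + 2 * π * c * (τ.im + |v.im| + |u.im|) with hC
  refine Summable.of_norm_bounded (g := fun i => gauss (2 * π * τ.im * ε) C (φ i))
    ((summable_gauss (by positivity) C).comp_injective hφ) fun i => ?_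
  rw [hf i, norm_mul]
  -- The bounds on the exponents are needed only where `s` is nonzero, so a sign factor may confine
  -- an indefinite form to a cone.
  by_cases h0 : s i = 0
  · rw [h0, norm_zero, zero_mul]; exact (Real.exp_pos _).le
  rw [norm_expo]
  refine (mul_le_mul_of_nonneg_right (hs i) (Real.exp_pos _).le).trans ?_
  rw [gauss, ← Real.exp_add]
  apply Real.exp_le_exp.mpr
  specialize hX i h0
  specialize hY i h0
  specialize hW i h0
  set t := 1 + |((φ i).1 : ℝ)| + |((φ i).2.1 : ℝ)| + |((φ i).2.2 : ℝ)| with ht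
  have h1 : |Y i * v.im| ≤ c * t * |v.im| := by
    rw [abs_mul]; exact mul_le_mul_of_nonneg_right hY (abs_nonneg _)
  have h2 : |W i * u.im| ≤ c * t * |u.im| := by
    rw [abs_mul]; exact mul_le_mul_of_nonneg_right hW (abs_nonneg _)
  have h3 := mul_le_mul_of_nonneg_right hX hτ.le
  have h4 := (abs_le.mp h1).1
  have h5 := (abs_le.mp h2).1
  have h6 := mul_le_mul_of_nonneg_left (add_le_add (add_le_add h3 h4) h5)
    (by positivity : (0 : ℝ) ≤ 2 * π)
  have h7 : C - 2 * π * τ.im * ε *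
      (((φ i).1 : ℝ) ^ 2 + ((φ i).2.1 : ℝ) ^ 2 + ((φ i).2.2 : ℝ) ^ 2) +
      C * (|((φ i).1 : ℝ)| + |((φ i).2.1 : ℝ)| + |((φ i).2.2 : ℝ)|) =
      C * t - 2 * π * τ.im * ε *
      (((φ i).1 : ℝ) ^ 2 + ((φ i).2.1 : ℝ) ^ 2 + ((φ i).2.2 : ℝ) ^ 2) := by
    rw [ht]; ring
  rw [h7, hC]
  linarith

lemma norm_neg_one_zpow (n : ℤ) : ‖(-1 : ℂ) ^ n‖ = 1 := by simp

lemma hasSum_of_eq {ι : Type*} {f g : ι → ℂ} {a b : ℂ} (h : HasSum f a) (hf : ∀ i, g i = f i)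
    (hb : b = a) : HasSum g b := by
  rw [hb, funext hf]; exact h

/-! ### Signed intervals and geometric sums -/

/-- The signed indicator of the integer interval between `0` and `a`. -/
def sgnInd (l a : ℤ) : ℂ := (if l < a then 1 else 0) - (if l < 0 then 1 else 0)

lemma sgnInd_succ (l a : ℤ) : sgnInd l (a + 1) = sgnInd l a + if l = a then 1 else 0 := by
  unfold sgnInd
  rcases lt_trichotomy l a with h | h | h
  · simp [h, h.ne, h.trans (lt_add_one a)]
  · simp [h]; ring
  · simp [not_lt.mpr h.le, h.ne', not_lt.mpr (Int.add_one_le_iff.mpr h)]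

lemma norm_sgnInd_le (l a : ℤ) : ‖sgnInd l a‖ ≤ 1 := by
  unfold sgnInd; split_ifs <;> simp

lemma sgnInd_ne_zero {l a : ℤ} (h : sgnInd l a ≠ 0) : (0 ≤ l ∧ l < a) ∨ (a ≤ l ∧ l < 0) := by
  unfold sgnInd at h
  split_ifs at h with h1 h2 h2
  · simp at h
  · exact Or.inl ⟨not_lt.mp h2, h1⟩
  · exact Or.inr ⟨not_lt.mp h1, h2⟩
  · simp at h

/-- The signed indicator makes one formula serve exponents `a` of both signs; for `a < 0` the terms
`a ≤ l < 0` enter with a minus sign. -/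
lemma hasSum_sgnInd_mul_zpow {Y : ℂ} (hY0 : Y ≠ 0) (hY : Y ≠ 1) (a : ℤ) :
    HasSum (fun l : ℤ => sgnInd l a * Y ^ l) ((1 - Y ^ a) / (1 - Y)) := by
  have h1 : 1 - Y ≠ 0 := sub_ne_zero.mpr hY.symm
  have key (a : ℤ) : HasSum (fun l : ℤ => (if l = a then (1 : ℂ) else 0) * Y ^ l) (Y ^ a) := by
    convert hasSum_ite_eq a (Y ^ a) using 2 with l
    split_ifs with h <;> simp [h]
  induction a using Int.induction_on with
  | zero => simp [sgnInd, hasSum_zero]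
  | succ n ih =>
    convert ih.add (key n) using 1
    · ext l; rw [sgnInd_succ, add_mul]
    · rw [zpow_add_one₀ hY0]; field_simp; ring
  | pred n ih =>
    have hf : (fun l : ℤ => sgnInd l (-n - 1) * Y ^ l) = fun l : ℤ =>
        sgnInd l (-n) * Y ^ l - (if l = -n - 1 then (1 : ℂ) else 0) * Y ^ l := by
      ext l
      have := sgnInd_succ l (-n - 1)
      rw [sub_add_cancel] at this
      rw [this]; ring
    have hv : (1 - Y ^ (-n - 1 : ℤ)) / (1 - Y) =
        (1 - Y ^ (-n : ℤ)) / (1 - Y) - Y ^ (-n - 1 : ℤ) := by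
      rw [zpow_sub_one₀ hY0]; field_simp; ring
    rw [hf, hv]
    exact ih.sub (key _)

/-! ### Jacobi's identity from a finite q-binomial version -/

lemma qPow_eq_expo (τ : ℂ) (x : ℝ) : qPow τ x = expo τ 0 0 x 0 0 := by
  simp only [qPow, expo]; congr 1; push_cast; ring

lemma qPow_add (τ : ℂ) (x y : ℝ) : qPow τ (x + y) = qPow τ x * qPow τ y := by
  simp only [qPow, ← Complex.exp_add]; congr 1; push_cast; ring

lemma qPow_zero (τ : ℂ) : qPow τ 0 = 1 := by simp [qPow]

lemma qPow_ne_zero (τ : ℂ) (x : ℝ) : qPow τ x ≠ 0 := Complex.exp_ne_zero _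

lemma qPow_neg (τ : ℂ) (x : ℝ) : qPow τ (-x) = (qPow τ x)⁻¹ := by
  refine eq_inv_of_mul_eq_one_left ?_
  rw [← qPow_add, neg_add_cancel, qPow_zero]

lemma norm_qPow (τ : ℂ) (x : ℝ) : ‖qPow τ x‖ = Real.exp (-(2 * π * (x * τ.im))) := by
  rw [qPow_eq_expo, norm_expo]; simp

lemma qPow_ne_one {τ : ℂ} (hτ : 0 < τ.im) {x : ℝ} (hx : x ≠ 0) : qPow τ x ≠ 1 := by
  intro h
  have h2 := norm_qPow τ x
  rw [h, norm_one, eq_comm, Real.exp_eq_one_iff] at h2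
  have : (2 * π * (x * τ.im)) ≠ 0 := by positivity
  exact this (by linarith)

/-- The finite product `∏ (1 - q ^ (2 i))` over `1 ≤ i ≤ n`. -/
def eulerProd (τ : ℂ) (n : ℕ) : ℂ := ∏ i ∈ Finset.range n, (1 - ModularForm.eta_q i (2 * τ))

lemma eta_q_two_mul (τ : ℂ) (n : ℕ) : ModularForm.eta_q n (2 * τ) = qPow τ (2 * (n + 1)) := by
  rw [ModularForm.eta_q_eq_cexp, qPow]; congr 1; push_cast; ring

lemma two_mul_mem_upperHalfPlaneSet {τ : ℂ} (hτ : 0 < τ.im) :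
    2 * τ ∈ UpperHalfPlane.upperHalfPlaneSet := by
  simpa [UpperHalfPlane.upperHalfPlaneSet] using hτ

lemma eulerProd_ne_zero {τ : ℂ} (hτ : 0 < τ.im) (n : ℕ) : eulerProd τ n ≠ 0 :=
  Finset.prod_ne_zero_iff.mpr fun i _ =>
    ModularForm.one_sub_eta_q_ne_zero i (two_mul_mem_upperHalfPlaneSet hτ)

lemma eulerProd_succ (τ : ℂ) (n : ℕ) :
    eulerProd τ (n + 1) = eulerProd τ n * (1 - qPow τ (2 * (n + 1))) := by
  rw [eulerProd, Finset.prod_range_succ, eta_q_two_mul, eulerProd]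

lemma tendsto_eulerProd {τ : ℂ} (hτ : 0 < τ.im) :
    Filter.Tendsto (eulerProd τ) Filter.atTop
      (nhds (∏' n, (1 - ModularForm.eta_q n (2 * τ)))) := by
  have h := ModularForm.summable_eta_q ⟨2 * τ, two_mul_mem_upperHalfPlaneSet hτ⟩
  have := (multipliable_one_add_of_summable h).tendsto_prod_tprod_nat
  simp only [← sub_eq_add_neg] at this
  exact this

/-- The reciprocal of `eulerProd`, extended by zero to negative indices. -/
def eulerInv (τ : ℂ) (m : ℤ) : ℂ := if 0 ≤ m then (eulerProd τ m.toNat)⁻¹ else 0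

/-- The extension by zero is consistent with the recursion because the factor `1 - q^(2m)` vanishes
at `m = 0`; no boundary cases remain later. -/
lemma eulerInv_sub_one {τ : ℂ} (hτ : 0 < τ.im) {m n : ℤ} {x : ℝ} (hn : n = m - 1)
    (hx : x = 2 * m) : eulerInv τ n = (1 - qPow τ x) * eulerInv τ m := by
  subst hn hx
  unfold eulerInv
  rcases lt_trichotomy m 0 with h | h | h
  · rw [if_neg (by omega), if_neg (by omega), mul_zero]
  · subst h; simp [qPow_zero]
  · rw [if_pos (by omega), if_pos h.le]
    obtain ⟨k, rfl⟩ : ∃ k : ℕ, m = k + 1 := ⟨(m - 1).toNat, by omega⟩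
    have h1 : ((k : ℤ) + 1 - 1).toNat = k := by omega
    have h2 : ((k : ℤ) + 1).toNat = k + 1 := by omega
    have h3 := eulerProd_ne_zero hτ (k + 1)
    rw [h1, h2]
    rw [eulerProd_succ] at h3 ⊢
    push_cast
    have h4 := right_ne_zero_of_mul h3
    have h5 := left_ne_zero_of_mul h3
    field_simp

lemma tendsto_eulerInv {τ : ℂ} (hτ : 0 < τ.im) (k : ℤ) :
    Filter.Tendsto (fun N : ℕ => eulerInv τ (N + k)) Filter.atTop
      (nhds (∏' n, (1 - ModularForm.eta_q n (2 * τ)))⁻¹) := by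
  have h := (tendsto_eulerProd hτ).inv₀
    (ModularForm.eta_tprod_ne_zero (two_mul_mem_upperHalfPlaneSet hτ))
  have h2 : Filter.Tendsto (fun N : ℕ => ((N : ℤ) + k).toNat) Filter.atTop Filter.atTop := by
    refine Filter.tendsto_atTop.mpr fun b => ?_
    filter_upwards [Filter.eventually_ge_atTop (b + k.natAbs)] with N hN
    omega
  refine (h.comp h2).congr' ?_
  filter_upwards [Filter.eventually_ge_atTop k.natAbs] with N hN
  rw [eulerInv, if_pos (by omega)]
  rfl

lemma exists_norm_eulerInv_le {τ : ℂ} (hτ : 0 < τ.im) :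
    ∃ C : ℝ, 0 ≤ C ∧ ∀ m, ‖eulerInv τ m‖ ≤ C := by
  obtain ⟨C, hC⟩ := (tendsto_eulerInv hτ 0).norm.bddAbove_range
  have h0 : ∀ N : ℕ, ‖eulerInv τ N‖ ≤ C := fun N => by
    simpa using hC (Set.mem_range_self N)
  have hC0 : 0 ≤ C := (norm_nonneg _).trans (h0 0)
  refine ⟨C, hC0, fun m => ?_⟩
  by_cases hm : 0 ≤ m
  · lift m to ℕ using hm; exact h0 m
  · rw [eulerInv, if_neg hm, norm_zero]; exact hC0

/-- A multiple of the `q`-binomial coefficient of `2 N + 1` over `N - n`. -/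
def eulerBinom (τ : ℂ) (N : ℕ) (n : ℤ) : ℂ := eulerInv τ (N - n) * eulerInv τ (N + n + 1)

lemma eulerBinom_eq_zero (τ : ℂ) {N : ℕ} {n : ℤ} (h : n ∉ Finset.Icc (-(N : ℤ) - 1) N) :
    eulerBinom τ N n = 0 := by
  rw [Finset.mem_Icc, not_and_or] at h
  unfold eulerBinom eulerInv
  rcases h with h | h
  · rw [if_neg (c := 0 ≤ (N : ℤ) + n + 1) (by omega), mul_zero]
  · rw [if_neg (c := 0 ≤ (N : ℤ) - n) (by omega), zero_mul]

/-- The analogue of two q-Pascal steps, from `2N+1` to `2N+3`. All terms are multiples of the same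
product of two values of `eulerInv`, which leaves a polynomial identity. -/
lemma eulerBinom_succ {τ : ℂ} (hτ : 0 < τ.im) (N : ℕ) (n : ℤ) :
    (1 - qPow τ (2 * (2 * N + 2))) * (1 - qPow τ (2 * (2 * N + 3))) * eulerBinom τ (N + 1) n =
      qPow τ (2 * (N + n + 2)) * eulerBinom τ N (n + 1) +
      (1 + qPow τ (2 * (2 * N + 2))) * eulerBinom τ N n +
      qPow τ (2 * (N + 1 - n)) * eulerBinom τ N (n - 1) := by
  have e1 : eulerInv τ (N - n) = (1 - qPow τ (2 * (N + 1 - n))) * eulerInv τ (N + 1 - n) :=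
    eulerInv_sub_one hτ (by ring) (by push_cast; ring)
  have e2 : eulerInv τ (N - n - 1) = (1 - qPow τ (2 * (N - n))) * eulerInv τ (N - n) :=
    eulerInv_sub_one hτ (by ring) (by push_cast; ring)
  have e3 : eulerInv τ (N + n + 1) = (1 - qPow τ (2 * (N + n + 2))) * eulerInv τ (N + n + 2) :=
    eulerInv_sub_one hτ (by ring) (by push_cast; ring)
  have e4 : eulerInv τ (N + n) = (1 - qPow τ (2 * (N + n + 1))) * eulerInv τ (N + n + 1) :=
    eulerInv_sub_one hτ (by ring) (by push_cast; ring)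
  have b1 : eulerBinom τ (N + 1) n = eulerInv τ (N + 1 - n) * eulerInv τ (N + n + 2) := by
    unfold eulerBinom; push_cast; ring_nf
  have b2 : eulerBinom τ N (n + 1) = eulerInv τ (N - n - 1) * eulerInv τ (N + n + 2) := by
    unfold eulerBinom; ring_nf
  have b3 : eulerBinom τ N (n - 1) = eulerInv τ (N + 1 - n) * eulerInv τ (N + n) := by
    unfold eulerBinom; ring_nf
  rw [b1, b2, b3, eulerBinom, e2, e4, e1, e3]
  have q1 : qPow τ (2 * (2 * N + 2)) = qPow τ (2 * N) ^ 2 * qPow τ 2 ^ 2 := by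
    simp only [pow_two, ← qPow_add]; congr 1; ring
  have q2 : qPow τ (2 * (2 * N + 3)) = qPow τ (2 * N) ^ 2 * qPow τ 2 ^ 3 := by
    simp only [pow_succ, pow_zero, one_mul, ← qPow_add]; congr 1; ring
  have q3 : qPow τ (2 * (N + 1 - n)) = qPow τ (2 * N) * qPow τ 2 * (qPow τ (2 * n))⁻¹ := by
    simp only [← qPow_neg, ← qPow_add]; congr 1; ring
  have q4 : qPow τ (2 * (N - n)) = qPow τ (2 * N) * (qPow τ (2 * n))⁻¹ := by
    simp only [← qPow_neg, ← qPow_add]; congr 1; ring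
  have q5 : qPow τ (2 * (N + n + 2)) = qPow τ (2 * N) * qPow τ (2 * n) * qPow τ 2 ^ 2 := by
    simp only [pow_two, ← qPow_add]; congr 1; ring
  have q6 : qPow τ (2 * (N + n + 1)) = qPow τ (2 * N) * qPow τ (2 * n) * qPow τ 2 := by
    simp only [← qPow_add]; congr 1; ring
  rw [q1, q2, q3, q4, q5, q6]
  have := qPow_ne_zero τ (2 * n)
  field_simp
  ring

/-- The coefficients of Jacobi's series for the cube of the Euler product. -/
def jacobiCoeff (τ : ℂ) (n : ℤ) : ℂ := (-1) ^ n * (2 * n + 1) * qPow τ (n ^ 2 + n)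

/-- The transpose of the recurrence of `eulerBinom_succ` has Jacobi's coefficients as an
eigenvector. Both neighbours acquire the same power of `q`, and `(2n-1) + (2n+3) = 2(2n+1)`, so the
factor is `1 - 2Q + Q²` with `Q = q^(2(N+1))`. -/
lemma jacobiCoeff_recurrence (τ : ℂ) (N : ℕ) (n : ℤ) :
    jacobiCoeff τ (n - 1) * qPow τ (2 * (N + n + 1)) +
      jacobiCoeff τ n * (1 + qPow τ (2 * (2 * N + 2))) +
      jacobiCoeff τ (n + 1) * qPow τ (2 * (N - n)) =
      (1 - qPow τ (2 * (N + 1))) ^ 2 * jacobiCoeff τ n := by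
  unfold jacobiCoeff
  have q1 : qPow τ ((n - 1 : ℤ) ^ 2 + (n - 1 : ℤ)) * qPow τ (2 * (N + n + 1)) =
      qPow τ (n ^ 2 + n) * qPow τ (2 * (N + 1)) := by
    simp only [← qPow_add]; congr 1; push_cast; ring
  have q2 : qPow τ ((n + 1 : ℤ) ^ 2 + (n + 1 : ℤ)) * qPow τ (2 * (N - n)) =
      qPow τ (n ^ 2 + n) * qPow τ (2 * (N + 1)) := by
    simp only [← qPow_add]; congr 1; push_cast; ring
  have q3 : qPow τ (2 * (2 * N + 2)) = qPow τ (2 * (N + 1)) ^ 2 := by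
    simp only [pow_two, ← qPow_add]; congr 1; ring
  have s1 : (-1 : ℂ) ^ (n - 1) = -(-1) ^ n := by rw [zpow_sub_one₀ (by norm_num)]; simp
  have s2 : (-1 : ℂ) ^ (n + 1) = -(-1) ^ n := by rw [zpow_add_one₀ (by norm_num)]; simp
  rw [mul_assoc, mul_assoc _ (qPow τ ((n + 1 : ℤ) ^ 2 + (n + 1 : ℤ))), q1, q2, q3, s1, s2]
  push_cast
  ring

lemma summable_jacobiCoeff {τ : ℂ} (hτ : 0 < τ.im) : Summable (jacobiCoeff τ) := by
  refine summable_expo hτ 0 0 (φ := fun n : ℤ => (n, 0, 0)) (fun a b h => (Prod.mk.inj h).1)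
    (s := fun n => (-1) ^ n * (2 * n + 1)) (X := fun n => (n : ℝ) ^ 2 + n) (Y := fun _ => 0)
    (W := fun _ => 0) (ε := 1) (c := 1) (b := 2) (fun n => ?_) one_pos (fun n => ?_)
    (fun n _ => ?_) (fun n _ => ?_) fun n _ => ?_
  · rw [jacobiCoeff, qPow_eq_expo]
  · rw [norm_mul, norm_neg_one_zpow, one_mul]
    refine le_trans ?_ (Real.add_one_le_exp _)
    refine (norm_add_le _ _).trans ?_
    simp
  · simp; linarith [neg_abs_le (n : ℝ)]
  · simp; positivity
  · simp; positivity

/-- The finite form of Jacobi's identity. In the induction the recurrence is moved by index shifts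
from the binomials to the coefficients, where it acts as a scalar. -/
lemma hasSum_jacobiCoeff_mul_eulerBinom {τ : ℂ} (hτ : 0 < τ.im) (N : ℕ) :
    HasSum (fun n => jacobiCoeff τ n * eulerBinom τ N n)
      (2 * eulerProd τ N ^ 2 * (eulerProd τ (2 * N + 1))⁻¹) := by
  induction N with
  | zero =>
    have h := hasSum_sum_of_ne_finset_zero (L := .unconditional ℤ)
      (f := fun n => jacobiCoeff τ n * eulerBinom τ 0 n)
      (s := Finset.Icc (-((0 : ℕ) : ℤ) - 1) (0 : ℕ))
      fun n hn => by rw [eulerBinom_eq_zero τ hn, mul_zero]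
    refine hasSum_of_eq h (fun _ => rfl) ?_
    have : Finset.Icc (-((0 : ℕ) : ℤ) - 1) (0 : ℕ) = {-1, 0} := by decide
    rw [this, Finset.sum_pair (by norm_num)]
    simp [jacobiCoeff, eulerBinom, eulerInv, eulerProd, qPow_zero]
    ring
  | succ N ih =>
    have hs (g : ℤ → ℂ) (k : ℤ) : Summable fun n => g n * eulerBinom τ N (n + k) := by
      have : Summable fun n => g (n - k) * eulerBinom τ N n :=
        summable_of_ne_finset_zero (s := Finset.Icc (-(N : ℤ) - 1) N)
          fun n hn => by rw [eulerBinom_eq_zero τ hn, mul_zero]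
      refine ((Equiv.addRight k).summable_iff.mpr this).congr fun n => ?_
      simp
    have hshift (g : ℤ → ℂ) (k : ℤ) : HasSum (fun n => g n * eulerBinom τ N (n + k))
        (∑' n, g (n - k) * eulerBinom τ N n) := by
      rw [← (Equiv.addRight k).tsum_eq]
      simpa using (hs g k).hasSum
    have h0 (g : ℤ → ℂ) : Summable fun n => g n * eulerBinom τ N n := by simpa using hs g 0
    have h1 := hshift (fun n => jacobiCoeff τ n * qPow τ (2 * (N + n + 2))) 1
    have h2 := (h0 (fun n => jacobiCoeff τ n * (1 + qPow τ (2 * (2 * N + 2))))).hasSum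
    have h3 := hshift (fun n => jacobiCoeff τ n * qPow τ (2 * (N + 1 - n))) (-1)
    have h4 := (h1.add h2).add h3
    rw [← Summable.tsum_add (h0 _) (h0 _),
      ← Summable.tsum_add ((h0 _).add (h0 _)) (h0 _)] at h4
    have hA : (1 - qPow τ (2 * (2 * N + 2))) ≠ 0 :=
      sub_ne_zero.mpr (qPow_ne_one hτ (by positivity)).symm
    have hB : (1 - qPow τ (2 * (2 * N + 3))) ≠ 0 :=
      sub_ne_zero.mpr (qPow_ne_one hτ (by positivity)).symm
    have h5 := h4.mul_left
      ((1 - qPow τ (2 * (2 * N + 2))) * (1 - qPow τ (2 * (2 * N + 3))))⁻¹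
    refine hasSum_of_eq h5 (fun n => ?_) ?_
    · rw [eq_inv_mul_iff_mul_eq₀ (mul_ne_zero hA hB), mul_left_comm, eulerBinom_succ hτ]
      ring_nf
    · rw [eq_inv_mul_iff_mul_eq₀ (mul_ne_zero hA hB)]
      have e : ∀ n : ℤ, jacobiCoeff τ (n - 1) * qPow τ (2 * (N + (n - 1 : ℤ) + 2)) *
            eulerBinom τ N n +
          jacobiCoeff τ n * (1 + qPow τ (2 * (2 * N + 2))) * eulerBinom τ N n +
          jacobiCoeff τ (n - -1) * qPow τ (2 * (N + 1 - (n - -1 : ℤ))) * eulerBinom τ N n =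
          (1 - qPow τ (2 * (N + 1))) ^ 2 * (jacobiCoeff τ n * eulerBinom τ N n) := fun n => by
        rw [← mul_assoc, ← jacobiCoeff_recurrence, sub_neg_eq_add]
        push_cast
        ring_nf
      rw [tsum_congr e, tsum_mul_left, ih.tsum_eq]
      have e2 : 2 * (N + 1) + 1 = (2 * N + 1) + 1 + 1 := by ring
      rw [e2, eulerProd_succ, eulerProd_succ, eulerProd_succ]
      have e3 : (2 * (((2 * N + 1 + 1 : ℕ) : ℝ) + 1)) = 2 * (2 * N + 3) := by push_cast; ring
      have e4 : (2 * (((2 * N + 1 : ℕ) : ℝ) + 1)) = 2 * (2 * N + 2) := by push_cast; ring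
      rw [e3, e4]
      have := eulerProd_ne_zero hτ (2 * N + 1)
      generalize 1 - qPow τ (2 * (2 * N + 2)) = A at hA ⊢
      generalize 1 - qPow τ (2 * (2 * N + 3)) = B at hB ⊢
      field_simp

/-- **Jacobi's identity** for the cube of the Euler product. -/
theorem tsum_jacobiCoeff {τ : ℂ} (hτ : 0 < τ.im) :
    ∑' n, jacobiCoeff τ n = 2 * (∏' n, (1 - ModularForm.eta_q n (2 * τ))) ^ 3 := by
  set E := ∏' n, (1 - ModularForm.eta_q n (2 * τ)) with hE
  have hE0 : E ≠ 0 := ModularForm.eta_tprod_ne_zero (two_mul_mem_upperHalfPlaneSet hτ)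
  obtain ⟨C, hC0, hC⟩ := exists_norm_eulerInv_le hτ
  -- Let `N → ∞` under the sum: each binomial tends to `E⁻²` and is uniformly bounded, while the
  -- closed form tends to `2E`.
  have h1 : Filter.Tendsto (fun N : ℕ => ∑' n, jacobiCoeff τ n * eulerBinom τ N n) Filter.atTop
      (nhds (∑' n, jacobiCoeff τ n * (E⁻¹ * E⁻¹))) := by
    refine tendsto_tsum_of_dominated_convergence
      ((summable_jacobiCoeff hτ).norm.mul_right (C * C)) (fun n => ?_)
      (Filter.Eventually.of_forall fun N n => ?_)
    · refine Filter.Tendsto.const_mul _ (Filter.Tendsto.mul ?_ ?_)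
      · exact tendsto_eulerInv hτ (-n)
      · simpa only [add_assoc] using tendsto_eulerInv hτ (n + 1)
    · rw [norm_mul, eulerBinom, norm_mul]
      gcongr <;> exact hC _
  have h2 : Filter.Tendsto (fun N : ℕ => ∑' n, jacobiCoeff τ n * eulerBinom τ N n) Filter.atTop
      (nhds (2 * E ^ 2 * E⁻¹)) := by
    simp_rw [(hasSum_jacobiCoeff_mul_eulerBinom hτ _).tsum_eq]
    have h3 := tendsto_eulerProd hτ
    refine ((h3.pow 2).const_mul 2).mul ((h3.comp ?_).inv₀ hE0)
    exact Filter.tendsto_atTop_mono (fun n => by simp; omega) Filter.tendsto_id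
  have h4 := tendsto_nhds_unique h1 h2
  rw [tsum_mul_right] at h4
  field_simp at h4
  rw [h4, mul_comm]

/-! ### Partial fractions of the reciprocal of ϑ₁₁ -/

lemma neg_one_zpow_add_one (n : ℤ) : (-1 : ℂ) ^ (n + 1) = -(-1) ^ n := by
  rw [zpow_add_one₀ (by norm_num)]; simp

lemma neg_one_zpow_neg (n : ℤ) : (-1 : ℂ) ^ (-n) = (-1) ^ n := by
  rw [zpow_neg, ← inv_zpow]; norm_num

lemma neg_one_zpow_sub (m n : ℤ) : (-1 : ℂ) ^ (m - n) = (-1) ^ m * (-1) ^ n := by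
  rw [sub_eq_add_neg, zpow_add₀ (by norm_num), neg_one_zpow_neg]

lemma neg_one_zpow_mul_self (n : ℤ) : (-1 : ℂ) ^ n * (-1) ^ n = 1 := by
  rw [← mul_zpow]; norm_num

/-- The coefficients of the theta series `ϑ₁₁ (2 τ, ·)`. -/
def thetaCoeff (τ : ℂ) (k : ℤ) : ℂ := (-1) ^ k * qPow τ ((k + 1 / 2) ^ 2)

lemma norm_thetaCoeff (τ : ℂ) (k : ℤ) :
    ‖thetaCoeff τ k‖ = Real.exp (-(2 * π * ((k + 1 / 2) ^ 2 * τ.im))) := by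
  rw [thetaCoeff, norm_mul, norm_neg_one_zpow, one_mul, norm_qPow]

lemma thetaCoeff_neg (τ : ℂ) (k : ℤ) : thetaCoeff τ (-1 - k) = -thetaCoeff τ k := by
  rw [thetaCoeff, thetaCoeff, neg_one_zpow_sub, show (-1 : ℂ) ^ (-1 : ℤ) = -1 by norm_num,
    neg_one_mul, neg_mul]
  congr 3
  push_cast
  ring

lemma summable_thetaCoeff_mul_expo {τ : ℂ} (hτ : 0 < τ.im) (w : ℂ) (α β γ : ℝ) :
    Summable fun k : ℤ => thetaCoeff τ k * expo τ w 0 (α * k) (β * k + γ) 0 := by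
  refine summable_expo hτ w 0 (φ := fun n : ℤ => (n, 0, 0)) (fun a b h => (Prod.mk.inj h).1)
    (s := fun k => (-1) ^ k) (X := fun k => ((k : ℝ) + 1 / 2) ^ 2 + α * k)
    (Y := fun k => β * k + γ)
    (W := fun _ => 0) (ε := 1) (c := 1 + |α| + |β| + |γ|) (b := 0) (fun k => ?_) one_pos
    (fun k => ?_) (fun k _ => ?_) (fun k _ => ?_) fun k _ => ?_
  · rw [thetaCoeff, qPow_eq_expo, mul_assoc]
    have : expo τ 0 0 (((k : ℝ) + 1 / 2) ^ 2) 0 0 = expo τ w 0 (((k : ℝ) + 1 / 2) ^ 2) 0 0 := by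
      simp [expo]
    rw [this, expo_mul_eq τ w 0 rfl (zero_add _) (zero_add _)]
  · simp
  · have h1 := neg_abs_le (α * k)
    rw [abs_mul] at h1
    have h2 := neg_abs_le (k : ℝ)
    simp
    nlinarith [abs_nonneg α, abs_nonneg β, abs_nonneg γ, abs_nonneg (k : ℝ),
      mul_nonneg (abs_nonneg β) (abs_nonneg (k : ℝ)),
      mul_nonneg (abs_nonneg γ) (abs_nonneg (k : ℝ))]
  · have h1 := abs_add_le (β * k) γ
    rw [abs_mul] at h1
    simp
    nlinarith [abs_nonneg α, abs_nonneg β, abs_nonneg γ, abs_nonneg (k : ℝ),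
      mul_nonneg (abs_nonneg α) (abs_nonneg (k : ℝ)),
      mul_nonneg (abs_nonneg γ) (abs_nonneg (k : ℝ))]
  · simp; positivity

lemma summable_thetaCoeff {τ : ℂ} (hτ : 0 < τ.im) : Summable (thetaCoeff τ) := by
  simpa [expo_zero] using summable_thetaCoeff_mul_expo hτ 0 0 0 0

/-- The tails of the series of `thetaCoeff`. -/
def thetaTail (τ : ℂ) (d : ℤ) : ℂ := ∑' k, if d ≤ k then thetaCoeff τ k else 0

lemma summable_ite_thetaCoeff {τ : ℂ} (hτ : 0 < τ.im) (p : ℤ → Prop) [DecidablePred p] :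
    Summable fun k => if p k then thetaCoeff τ k else 0 := by
  refine Summable.of_norm_bounded (summable_thetaCoeff hτ).norm fun k => ?_
  split_ifs <;> simp

/-- Oddness under `k ↦ -1-k`; this is the zero of `ϑ₁₁(2τ, ·)` at the origin. -/
lemma tsum_thetaCoeff (τ : ℂ) : ∑' k, thetaCoeff τ k = 0 := by
  have h : ∑' k, thetaCoeff τ k = -∑' k, thetaCoeff τ k := by
    rw [← tsum_neg, ← (Equiv.subLeft (-1 : ℤ)).tsum_eq (thetaCoeff τ)]
    exact tsum_congr fun k => thetaCoeff_neg τ k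
  exact self_eq_neg.mp h

lemma thetaTail_sub {τ : ℂ} (hτ : 0 < τ.im) (d : ℤ) :
    thetaTail τ d - thetaTail τ (d + 1) = thetaCoeff τ d := by
  rw [thetaTail, thetaTail, ← (summable_ite_thetaCoeff hτ _).tsum_sub
    (summable_ite_thetaCoeff hτ _), ← tsum_ite_eq d (thetaCoeff τ)]
  refine tsum_congr fun k => ?_
  rcases lt_trichotomy k d with h | h | h
  · simp [not_le.mpr h, h.ne, not_le.mpr (h.trans (lt_add_one d))]
  · simp [h]
  · simp [h.le, h.ne', Int.add_one_le_iff.mpr h]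

/-- Reflection turns the tail from `-d` into minus the sum over `k < d`, which is the tail from `d`
since the full sum is zero. Decay for `d ≥ 0` thus carries over to `d < 0`. -/
lemma thetaTail_neg {τ : ℂ} (hτ : 0 < τ.im) (d : ℤ) : thetaTail τ (-d) = thetaTail τ d := by
  have h1 : thetaTail τ (-d) = ∑' k, -(if k < d then thetaCoeff τ k else 0) := by
    rw [thetaTail, ← (Equiv.subLeft (-1 : ℤ)).tsum_eq]
    refine tsum_congr fun k => ?_
    simp only [Equiv.subLeft_apply, thetaCoeff_neg]
    by_cases h : d ≤ k
    · rw [if_neg (by omega), if_neg (by omega), neg_zero]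
    · rw [if_pos (by omega), if_pos (by omega)]
  have h2 : thetaTail τ d + ∑' k, (if k < d then thetaCoeff τ k else 0) = 0 := by
    refine Eq.trans ?_ (tsum_thetaCoeff τ)
    rw [thetaTail, ← (summable_ite_thetaCoeff hτ fun k => d ≤ k).tsum_add
      (summable_ite_thetaCoeff hτ fun k => k < d)]
    refine tsum_congr fun k => ?_
    by_cases h : d ≤ k
    · rw [if_pos h, if_neg (by omega), add_zero]
    · rw [if_neg h, if_pos (by omega), zero_add]
  rw [h1, tsum_neg, eq_comm]
  exact eq_neg_of_add_eq_zero_left h2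

/-- For `k ≥ d ≥ 0` one has `(k + 1/2)² ≥ d² + (k - d + 1/2)²`, so `|q|^(d²)` factors out of the
tail. -/
lemma exists_norm_thetaTail_le {τ : ℂ} (hτ : 0 < τ.im) :
    ∃ C : ℝ, 0 ≤ C ∧ ∀ d : ℤ, ‖thetaTail τ d * qPow τ (-(d : ℝ) ^ 2)‖ ≤ C := by
  have hs := (summable_thetaCoeff hτ).norm
  refine ⟨∑' k, ‖thetaCoeff τ k‖, tsum_nonneg fun _ => norm_nonneg _, fun d => ?_⟩
  have main (d : ℤ) (hd : 0 ≤ d) : ‖thetaTail τ d‖ ≤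
      Real.exp (-(2 * π * ((d : ℝ) ^ 2 * τ.im))) * ∑' k, ‖thetaCoeff τ k‖ := by
    rw [← (Equiv.subRight d).tsum_eq (fun k => ‖thetaCoeff τ k‖)]
    refine tsum_of_norm_bounded
      (((Equiv.subRight d).summable_iff.mpr hs).hasSum.mul_left _) fun k => ?_
    split_ifs with h
    · simp only [Function.comp_apply, Equiv.subRight_apply, norm_thetaCoeff, ← Real.exp_add]
      apply Real.exp_le_exp.mpr
      have h1 : (0 : ℝ) ≤ d := by exact_mod_cast hd
      have h2 : (d : ℝ) ≤ k := by exact_mod_cast h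
      have h3 : (d : ℝ) ^ 2 + (((k - d : ℤ) : ℝ) + 1 / 2) ^ 2 ≤ ((k : ℝ) + 1 / 2) ^ 2 := by
        push_cast
        nlinarith [mul_nonneg h1 (sub_nonneg.mpr h2)]
      have h4 := mul_le_mul_of_nonneg_left (mul_le_mul_of_nonneg_right h3 hτ.le)
        (by positivity : (0 : ℝ) ≤ 2 * π)
      linarith
    · rw [norm_zero]
      exact mul_nonneg (Real.exp_pos _).le (norm_nonneg _)
  have main2 : ‖thetaTail τ d‖ ≤
      Real.exp (-(2 * π * ((d : ℝ) ^ 2 * τ.im))) * ∑' k, ‖thetaCoeff τ k‖ := by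
    rcases le_total 0 d with h | h
    · exact main d h
    · have := main (-d) (by omega)
      rw [thetaTail_neg hτ] at this
      simpa using this
  rw [norm_mul, norm_qPow]
  refine (mul_le_mul_of_nonneg_right main2 (Real.exp_pos _).le).trans (le_of_eq ?_)
  rw [mul_right_comm, ← Real.exp_add]
  ring_nf
  simp

lemma qPow_mul_expo (τ w u : ℂ) (a x y z : ℝ) :
    qPow τ a * expo τ w u x y z = expo τ w u (a + x) y z := by
  have : qPow τ a = expo τ w u a 0 0 := by simp [expo, qPow]; ring_nf
  rw [this, expo_mul_eq τ w u rfl (zero_add _) (zero_add _)]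

/-- The tail decays like `q^((l-n)²)`, and `(l-n)² + 2nl = n² + l²`. This licenses the interchange
of sums in `vartheta11_mul_tsum`. -/
lemma summable_thetaTail_prod {τ : ℂ} (hτ : 0 < τ.im) (w : ℂ) :
    Summable fun i : ℤ × ℤ => thetaTail τ (i.2 - i.1) * expo τ w 0 (2 * i.1 * i.2) i.2 0 := by
  obtain ⟨C, hC0, hC⟩ := exists_norm_thetaTail_le hτ
  refine summable_expo hτ w 0 (φ := fun i : ℤ × ℤ => (i.1, i.2, 0))
    (fun a b h => by simpa [Prod.ext_iff] using h)
    (s := fun i => thetaTail τ (i.2 - i.1) * qPow τ (-((i.2 - i.1 : ℤ) : ℝ) ^ 2))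
    (X := fun i => (i.1 : ℝ) ^ 2 + (i.2 : ℝ) ^ 2) (Y := fun i => i.2)
    (W := fun _ => 0) (ε := 1) (c := 1) (b := C) (fun i => ?_) one_pos
    (fun i => ?_) (fun i _ => ?_) (fun i _ => ?_) fun i _ => ?_
  · rw [mul_assoc (thetaTail τ _), qPow_mul_expo]
    congr 2; push_cast; ring
  · refine (hC _).trans (((by linarith : C ≤ C + 1)).trans ((Real.add_one_le_exp C).trans
      (Real.exp_le_exp.mpr ?_)))
    refine le_mul_of_one_le_right hC0 ?_
    simp only
    linarith [abs_nonneg (i.1 : ℝ), abs_nonneg (i.2 : ℝ), abs_nonneg ((0 : ℤ) : ℝ)]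
  · simp; positivity
  · simp; positivity
  · simp; positivity

lemma summable_thetaTail_mul {τ : ℂ} (hτ : 0 < τ.im) (α : ℝ) :
    Summable fun d : ℤ => (d : ℂ) * thetaTail τ d * qPow τ (α * d) := by
  obtain ⟨C, hC0, hC⟩ := exists_norm_thetaTail_le hτ
  refine summable_expo hτ 0 0 (φ := fun n : ℤ => (n, 0, 0)) (fun a b h => (Prod.mk.inj h).1)
    (s := fun d => d * (thetaTail τ d * qPow τ (-(d : ℝ) ^ 2)))
    (X := fun d => (d : ℝ) ^ 2 + α * d) (Y := fun _ => 0)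
    (W := fun _ => 0) (ε := 1) (c := |α|) (b := C + 1) (fun d => ?_) one_pos
    (fun d => ?_) (fun d _ => ?_) (fun d _ => ?_) fun d _ => ?_
  · simp only [mul_assoc, qPow_mul_expo]
    rw [qPow_eq_expo, neg_add_cancel_left]
  · rw [norm_mul]
    calc _ ≤ Real.exp |(d : ℝ)| * Real.exp C := by
          gcongr
          · have := Real.add_one_le_exp |(d : ℝ)|
            rw [Complex.norm_intCast]; linarith
          · have := Real.add_one_le_exp C
            linarith [hC d]
      _ ≤ _ := by
          rw [← Real.exp_add]
          apply Real.exp_le_exp.mpr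
          simp
          nlinarith [abs_nonneg (d : ℝ), mul_nonneg hC0 (abs_nonneg (d : ℝ))]
  · have h1 := neg_abs_le (α * d)
    rw [abs_mul] at h1
    simp
    nlinarith [abs_nonneg α]
  · simp; positivity
  · simp; positivity

lemma summable_thetaTail {τ : ℂ} (hτ : 0 < τ.im) (α : ℝ) :
    Summable fun d : ℤ => thetaTail τ d * qPow τ (α * d) := by
  refine Summable.of_norm_bounded_eventually (summable_thetaTail_mul hτ α).norm ?_
  rw [Filter.eventually_cofinite]
  refine (Set.finite_singleton (0 : ℤ)).subset fun d hd => ?_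
  by_contra h
  apply hd
  rw [mul_assoc, norm_mul (d : ℂ)]
  refine le_mul_of_one_le_left (norm_nonneg _) ?_
  rw [Complex.norm_intCast]
  exact_mod_cast Int.one_le_abs h

/-- The Laurent coefficients of `ϑ₁₁ (2 τ, w)` times its partial fraction series vanish, except
the constant one. -/
lemma tsum_thetaTail_mul_eq_zero {τ : ℂ} (hτ : 0 < τ.im) {l : ℤ} (hl : l ≠ 0) :
    ∑' d : ℤ, thetaTail τ d * qPow τ (-(2 * l) * d) = 0 := by
  have hs := summable_thetaTail hτ (-(2 * l))
  have h1 : qPow τ (2 * l) * ∑' d : ℤ, thetaTail τ d * qPow τ (-(2 * l) * d) =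
      ∑' d : ℤ, thetaTail τ (d + 1) * qPow τ (-(2 * l) * d) := by
    rw [← tsum_mul_left, ← (Equiv.addRight (1 : ℤ)).tsum_eq]
    refine tsum_congr fun d => ?_
    simp only [Equiv.coe_addRight]
    rw [mul_left_comm, ← qPow_add]
    congr 2; push_cast; ring
  have hs1 : Summable fun d : ℤ => thetaTail τ (d + 1) * qPow τ (-(2 * l) * d) := by
    refine (((Equiv.addRight (1 : ℤ)).summable_iff.mpr hs).mul_left (qPow τ (2 * l))).congr
      fun d => ?_
    simp only [Function.comp_apply, Equiv.coe_addRight]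
    rw [mul_left_comm, ← qPow_add]
    congr 2; push_cast; ring
  -- Abel summation: the factor `1 - q^(2l)` turns tails into theta coefficients, and completing the
  -- square shifts these by `l`, so the vanishing total sum appears.
  have h2 : (1 - qPow τ (2 * l)) * ∑' d : ℤ, thetaTail τ d * qPow τ (-(2 * l) * d) =
      (-1) ^ l * qPow τ (-(l + (l : ℝ) ^ 2) + 2 * l) * ∑' d, thetaCoeff τ d := by
    rw [sub_mul, one_mul, h1, ← hs.tsum_sub hs1, ← (Equiv.subRight l).tsum_eq (thetaCoeff τ),
      ← tsum_mul_left]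
    refine tsum_congr fun d => ?_
    have e : qPow τ (((d : ℝ) + 1 / 2) ^ 2) * qPow τ (-(2 * l) * d) =
        qPow τ (-(l + (l : ℝ) ^ 2) + 2 * l) * qPow τ (((d - l : ℤ) + 1 / 2) ^ 2) := by
      rw [← qPow_add, ← qPow_add]; congr 1; push_cast; ring
    rw [← sub_mul, thetaTail_sub hτ, Equiv.subRight_apply, thetaCoeff, thetaCoeff,
      neg_one_zpow_sub]
    linear_combination (-1 : ℂ) ^ d * e - (-1 : ℂ) ^ d * qPow τ (-(l + (l : ℝ) ^ 2) + 2 * l) *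
      qPow τ (((d - l : ℤ) + 1 / 2) ^ 2) * neg_one_zpow_mul_self l
  rw [tsum_thetaCoeff, mul_zero] at h2
  refine (mul_eq_zero.mp h2).resolve_left (sub_ne_zero.mpr (qPow_ne_one hτ ?_).symm)
  exact mul_ne_zero two_ne_zero (by exact_mod_cast hl)

/-- Summation by parts gives `∑ d · thetaCoeff d`. Writing `d = ((2d+1) - 1)/2` produces half of
Jacobi's series, the other part summing to zero; `q^(1/4)` completes `η(2τ)³`. -/
lemma tsum_thetaTail {τ : ℂ} (hτ : 0 < τ.im) :
    ∑' d, thetaTail τ d = ModularForm.eta (2 * τ) ^ 3 := by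
  have hs : Summable (thetaTail τ) := by simpa [qPow_zero] using summable_thetaTail hτ 0
  have hs2 : Summable fun d : ℤ => (d : ℂ) * thetaTail τ d := by
    simpa [qPow_zero] using summable_thetaTail_mul hτ 0
  have hs3 : Summable fun d : ℤ => ((d - 1 : ℤ) : ℂ) * thetaTail τ d := by
    refine (hs2.sub hs).congr fun d => ?_
    push_cast; ring
  have h1 : ∑' d, thetaTail τ d = ∑' d : ℤ, (d : ℂ) * thetaCoeff τ d := by
    have e1 : ∑' d : ℤ, (d : ℂ) * thetaTail τ (d + 1) =
        ∑' d : ℤ, ((d - 1 : ℤ) : ℂ) * thetaTail τ d := by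
      rw [← (Equiv.addRight (1 : ℤ)).tsum_eq (fun d : ℤ => ((d - 1 : ℤ) : ℂ) * thetaTail τ d)]
      simp
    have e2 : Summable fun d : ℤ => (d : ℂ) * thetaTail τ (d + 1) := by
      refine ((Equiv.addRight (1 : ℤ)).summable_iff.mpr hs3).congr fun d => ?_
      simp
    calc _ = ∑' d : ℤ, ((d : ℂ) * thetaTail τ d - ((d - 1 : ℤ) : ℂ) * thetaTail τ d) := by
          refine tsum_congr fun d => ?_
          push_cast; ring
      _ = _ := by
          rw [hs2.tsum_sub hs3, ← e1, ← hs2.tsum_sub e2]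
          refine tsum_congr fun d => ?_
          rw [← thetaTail_sub hτ]; ring
  have h2 : ∀ d : ℤ, (d : ℂ) * thetaCoeff τ d =
      (1 / 2) * (qPow τ (1 / 4) * jacobiCoeff τ d) - 1 / 2 * thetaCoeff τ d := fun d => by
    have : qPow τ (((d : ℝ) + 1 / 2) ^ 2) = qPow τ (1 / 4) * qPow τ ((d : ℝ) ^ 2 + d) := by
      rw [← qPow_add]; congr 1; ring
    rw [thetaCoeff, jacobiCoeff, this]; ring
  have hj := ((summable_jacobiCoeff hτ).mul_left (qPow τ (1 / 4))).mul_left (1 / 2)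
  rw [h1, tsum_congr h2, hj.tsum_sub ((summable_thetaCoeff hτ).mul_left _), tsum_mul_left,
    tsum_mul_left, tsum_mul_left, tsum_thetaCoeff, tsum_jacobiCoeff hτ, ModularForm.eta, mul_pow]
  have : Function.Periodic.qParam 24 (2 * τ) ^ 3 = qPow τ (1 / 4) := by
    rw [Function.Periodic.qParam, qPow, ← Complex.exp_nat_mul]
    congr 1; push_cast; ring
  rw [this]; ring

lemma vartheta11_two_mul (τ w : ℂ) :
    vartheta11 (2 * τ) w = I * ∑' k : ℤ, thetaCoeff τ k * expo τ w 0 0 (k + 1 / 2) 0 := by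
  rw [vartheta11, ← tsum_mul_left]
  refine tsum_congr fun k => ?_
  have h1 : I * (-1 : ℂ) ^ k = Complex.exp (2 * π * I * (k + 1 / 2) * (1 / 2)) := by
    rw [← Complex.exp_pi_mul_I, ← Complex.exp_int_mul]
    nth_rewrite 1 [← Complex.exp_pi_div_two_mul_I]
    rw [← Complex.exp_add]
    congr 1; ring
  rw [thetaCoeff, mul_assoc ((-1 : ℂ) ^ k), ← mul_assoc I, h1, qPow_mul_expo, expo, ← Complex.exp_add]
  congr 1; push_cast; ring

/-- The partial fraction expansion of the reciprocal of `ϑ₁₁`. -/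
theorem vartheta11_mul_tsum {τ : ℂ} (hτ : 0 < τ.im) {w : ℂ}
    (hw : ∀ n : ℤ, expo τ w 0 (2 * n) 1 0 ≠ 1) :
    vartheta11 (2 * τ) w * ∑' n : ℤ, (-1) ^ n * expo τ w 0 ((n : ℝ) ^ 2 + n) (1 / 2) 0 /
      (1 - expo τ w 0 (2 * n) 1 0) = -I * ModularForm.eta (2 * τ) ^ 3 := by
  have hF := summable_thetaTail_prod hτ w
  -- Since ϑ₁₁ vanishes at the poles of the n-th summand, the product is a Laurent series in
  -- `e^(2πiw)`, with tails as coefficients.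
  have hterm (n : ℤ) : vartheta11 (2 * τ) w * ((-1) ^ n *
      expo τ w 0 ((n : ℝ) ^ 2 + n) (1 / 2) 0 / (1 - expo τ w 0 (2 * n) 1 0)) =
      -I * ∑' l : ℤ, thetaTail τ (l - n) * expo τ w 0 (2 * n * l) l 0 := by
    have h1 : 1 - expo τ w 0 (2 * n) 1 0 ≠ 0 := sub_ne_zero.mpr (hw n).symm
    have hs : Summable fun l : ℤ => thetaTail τ (l - n) * expo τ w 0 (2 * n * l) l 0 :=
      hF.prod_factor n
    have e1 : expo τ w 0 (2 * n) 1 0 *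
        ∑' l : ℤ, thetaTail τ (l - n) * expo τ w 0 (2 * n * l) l 0 =
        ∑' l : ℤ, thetaTail τ (l - 1 - n) * expo τ w 0 (2 * n * l) l 0 := by
      rw [← tsum_mul_left, ← (Equiv.addRight (1 : ℤ)).tsum_eq
        (fun l : ℤ => thetaTail τ (l - 1 - n) * expo τ w 0 (2 * n * l) l 0)]
      refine tsum_congr fun l => ?_
      simp only [Equiv.coe_addRight, add_sub_cancel_right]
      rw [mul_left_comm, expo_mul_eq τ w 0 (x'' := 2 * n * (l + 1 : ℤ)) (y'' := (l + 1 : ℤ))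
        (w'' := 0)] <;> push_cast <;> ring
    have hs1 : Summable fun l : ℤ => thetaTail τ (l - 1 - n) * expo τ w 0 (2 * n * l) l 0 := by
      refine ((Equiv.subRight (1 : ℤ)).summable_iff.mpr
        (hs.mul_left (expo τ w 0 (2 * n) 1 0))).congr fun l => ?_
      simp only [Function.comp_apply, Equiv.subRight_apply]
      rw [mul_left_comm, expo_mul_eq τ w 0 (x'' := 2 * n * l) (y'' := l)
        (w'' := 0)] <;> push_cast <;> ring
    have e2 : (1 - expo τ w 0 (2 * n) 1 0) *
        (∑' l : ℤ, thetaTail τ (l - n) * expo τ w 0 (2 * n * l) l 0) =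
        -∑' l : ℤ, thetaCoeff τ (l - 1 - n) * expo τ w 0 (2 * n * l) l 0 := by
      rw [sub_mul, one_mul, e1, ← hs.tsum_sub hs1, ← tsum_neg]
      refine tsum_congr fun l => ?_
      rw [← sub_mul, ← thetaTail_sub hτ, sub_right_comm, sub_add_cancel]
      ring
    rw [mul_div_assoc', div_eq_iff h1, mul_assoc, mul_comm _ (1 - _), e2, vartheta11_two_mul,
      mul_neg, neg_mul, neg_neg, mul_assoc, ← tsum_mul_right,
      ← (Equiv.subRight (1 : ℤ)).tsum_eq]
    congr 1
    refine tsum_congr fun l => ?_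
    simp only [Equiv.subRight_apply]
    have e3 : qPow τ (((l - 1 : ℤ) + 1 / 2) ^ 2) * expo τ w 0 0 ((l - 1 : ℤ) + 1 / 2) 0 *
        expo τ w 0 ((n : ℝ) ^ 2 + n) (1 / 2) 0 =
        qPow τ (((l - 1 - n : ℤ) + 1 / 2) ^ 2) * expo τ w 0 (2 * n * l) l 0 := by
      rw [qPow_mul_expo, qPow_mul_expo, expo_mul_eq τ w 0 rfl rfl rfl]
      congr 1 <;> push_cast <;> ring
    rw [thetaCoeff, thetaCoeff, neg_one_zpow_sub (l - 1)]
    linear_combination (-1 : ℂ) ^ (l - 1) * (-1 : ℂ) ^ n * e3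
  rw [← tsum_mul_left, tsum_congr hterm, tsum_mul_left]
  congr 1
  have hterm2 (l : ℤ) : ∑' n : ℤ, thetaTail τ (l - n) * expo τ w 0 (2 * n * l) l 0 =
      expo τ w 0 (2 * (l : ℝ) ^ 2) l 0 * ∑' d : ℤ, thetaTail τ d * qPow τ (-(2 * l) * d) := by
    rw [← tsum_mul_left, ← (Equiv.subLeft l).tsum_eq]
    refine tsum_congr fun d => ?_
    simp only [Equiv.subLeft_apply, sub_sub_cancel]
    rw [mul_left_comm, mul_comm (expo _ _ _ _ _ _), qPow_mul_expo]
    congr 2; push_cast; ring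
  -- Collecting powers of `e^(2πiw)` over all `n`, only the constant term survives.
  rw [← Summable.tsum_comm (f := fun n l : ℤ =>
    thetaTail τ (l - n) * expo τ w 0 (2 * n * l) l 0) hF, tsum_congr hterm2, tsum_eq_single 0]
  · simp [qPow_zero, expo_zero, tsum_thetaTail hτ]
  · intro l hl
    rw [tsum_thetaTail_mul_eq_zero hτ hl, mul_zero]

/-! ### Absolute convergence of the indefinite theta series -/

/-- For `l` between `0` and `a`, `nl` is at least `0` or at least `na`, being linear in `l`. At `l =
a` the form becomes `M(n+y)² + n²` up to lower order terms, which is definite; at `l = 0`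
definiteness is clear. -/
lemma quadratic_lower_bound {M n y l a X : ℝ} (hM : 2 ≤ M) (ha : a = M * y + n)
    (hl : (0 ≤ l ∧ l ≤ a) ∨ (a ≤ l ∧ l ≤ 0))
    (hX : X = (M - 1) * n ^ 2 + (M - 1) * y ^ 2 + (y - 1 / 2) ^ 2 + 2 * n * l) :
    1 / 2 * n ^ 2 + 1 / 4 * y ^ 2 - |y| ≤ X := by
  have hy := neg_abs_le y
  have hy' := le_abs_self y
  have key : 0 ≤ n * l ∨ n * a ≤ n * l := by
    rcases hl with ⟨h1, h2⟩ | ⟨h1, h2⟩ <;> rcases le_total 0 n with hn | hn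
    · exact Or.inl (mul_nonneg hn h1)
    · exact Or.inr (mul_le_mul_of_nonpos_left h2 hn)
    · exact Or.inr (mul_le_mul_of_nonneg_left h1 hn)
    · exact Or.inl (mul_nonneg_of_nonpos_of_nonpos hn h2)
  rcases key with h | h
  · nlinarith [mul_nonneg (sub_nonneg.mpr hM) (sq_nonneg n),
      mul_nonneg (sub_nonneg.mpr hM) (sq_nonneg y), sq_nonneg n, sq_nonneg y]
  · rw [ha] at h
    nlinarith [mul_nonneg (sub_nonneg.mpr hM) (sq_nonneg (n + y)), sq_nonneg (2 * n + 3 * y),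
      sq_nonneg (3 * n + 4 * y), sq_nonneg (n + y), sq_nonneg n, sq_nonneg y]

/-- The summands of the indefinite theta series attached to `Φ^[N/2,0]`, `N = 2 h + 1`. -/
def tripleTerm (h : ℕ) (τ v u : ℂ) (i : ℤ × ℤ × ℤ) : ℂ :=
  (sgnInd i.2.2 ((2 * h + 2) * i.2.1 + (h + 1) + i.1) * (-1) ^ i.2.1) *
    expo τ v u ((2 * h + 1) * (i.1 : ℝ) ^ 2 + (2 * h + 1) * ((i.2.1 : ℝ) + 1 / 2) ^ 2 +
      (i.2.1 : ℝ) ^ 2 + 2 * i.1 * i.2.2) (i.2.2 - (2 * h + 1) * ((i.2.1 : ℝ) + 1 / 2))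
      ((2 * h + 1) * i.1 + i.2.2)

lemma summable_tripleTerm (h : ℕ) {τ : ℂ} (hτ : 0 < τ.im) (v u : ℂ) :
    Summable (tripleTerm h τ v u) := by
  set M : ℝ := 2 * h + 2 with hM
  have hM2 : 2 ≤ M := by rw [hM]; linarith [(Nat.cast_nonneg h : (0 : ℝ) ≤ h)]
  have hMpos : 0 < M := by linarith
  have habs {n p l : ℤ} (h0 : sgnInd l ((2 * h + 2) * p + (h + 1) + n) * (-1) ^ p ≠ 0) :
      ((0 ≤ (l : ℝ) ∧ (l : ℝ) ≤ M * (p + 1 / 2) + n) ∨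
        (M * (p + 1 / 2) + n ≤ (l : ℝ) ∧ (l : ℝ) ≤ 0)) ∧ |(l : ℝ)| ≤ M * |(p : ℝ)| + M + |(n : ℝ)| := by
    have h1 := sgnInd_ne_zero (left_ne_zero_of_mul h0)
    have e : (((2 * h + 2) * p + (h + 1) + n : ℤ) : ℝ) = M * (p + 1 / 2) + n := by
      rw [hM]; push_cast; ring
    have h2 : ((0 ≤ (l : ℝ) ∧ (l : ℝ) ≤ M * (p + 1 / 2) + n) ∨
        (M * (p + 1 / 2) + n ≤ (l : ℝ) ∧ (l : ℝ) ≤ 0)) := by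
      rw [← e]
      rcases h1 with ⟨h1, h1'⟩ | ⟨h1, h1'⟩
      · exact Or.inl ⟨by exact_mod_cast h1, by exact_mod_cast h1'.le⟩
      · exact Or.inr ⟨by exact_mod_cast h1, by exact_mod_cast h1'.le⟩
    refine ⟨h2, ?_⟩
    have h3 := mul_le_mul_of_nonneg_left (neg_abs_le (p : ℝ)) hMpos.le
    have h4 := mul_le_mul_of_nonneg_left (le_abs_self (p : ℝ)) hMpos.le
    have h5 := neg_abs_le (n : ℝ)
    have h6 := le_abs_self (n : ℝ)
    rw [abs_le]
    rcases h2 with h2 | h2 <;> constructor <;> nlinarith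
  refine summable_expo hτ v u (φ := id) Function.injective_id
    (ε := 1 / (16 * M ^ 2)) (c := 2 * M) (b := 0) (fun i => rfl) (by positivity) (fun i => ?_)
    (fun i h0 => ?_) (fun i h0 => ?_) (fun i h0 => ?_)
  · rw [norm_mul, norm_neg_one_zpow, mul_one, zero_mul, Real.exp_zero]
    exact norm_sgnInd_le _ _
  · obtain ⟨n, p, l⟩ := i
    obtain ⟨h1, h2⟩ := habs h0
    simp only [id] at h1 h2 ⊢
    have h3 := quadratic_lower_bound (X := (2 * h + 1) * (n : ℝ) ^ 2 +
      (2 * h + 1) * ((p : ℝ) + 1 / 2) ^ 2 + (p : ℝ) ^ 2 + 2 * n * l) hM2 rfl h1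
      (by rw [hM]; ring)
    refine le_trans ?_ h3
    have h4 : (l : ℝ) ^ 2 ≤ 3 * (M ^ 2 * (p : ℝ) ^ 2 + M ^ 2 + (n : ℝ) ^ 2) := by
      have := pow_le_pow_left₀ (abs_nonneg _) h2 2
      rw [sq_abs] at this
      rw [← sq_abs (p : ℝ), ← sq_abs (n : ℝ)]
      nlinarith [sq_nonneg (M * |(p : ℝ)| - M), sq_nonneg (M * |(p : ℝ)| - |(n : ℝ)|),
        sq_nonneg (M - |(n : ℝ)|)]
    have h5 : 1 / (16 * M ^ 2) * ((n : ℝ) ^ 2 + (p : ℝ) ^ 2 + (l : ℝ) ^ 2) ≤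
        1 / 4 * (n : ℝ) ^ 2 + 1 / 4 * (p : ℝ) ^ 2 + 1 / 4 := by
      rw [div_mul_eq_mul_div, one_mul, div_le_iff₀ (by positivity)]
      have : 1 ≤ M ^ 2 := by nlinarith
      nlinarith [mul_nonneg (sub_nonneg.mpr this) (sq_nonneg (n : ℝ)),
        mul_nonneg (sub_nonneg.mpr this) (sq_nonneg (p : ℝ))]
    have h6 : |(p : ℝ) + 1 / 2| ≤ |(p : ℝ)| + 1 / 2 := by
      refine (abs_add_le _ _).trans ?_
      norm_num
    have h7 := neg_abs_le (p : ℝ)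
    have h8 := abs_nonneg (p : ℝ)
    have h9 := mul_nonneg (sub_nonneg.mpr hM2) h8
    have h10 := mul_nonneg hMpos.le (abs_nonneg (n : ℝ))
    have h11 := mul_nonneg hMpos.le (abs_nonneg (l : ℝ))
    nlinarith [sq_nonneg (n : ℝ)]
  · obtain ⟨n, p, l⟩ := i
    simp only [id] at h0 ⊢
    have e : ((2 * h + 1 : ℝ)) = M - 1 := by rw [hM]; ring
    rw [e]
    have h1 := neg_abs_le (p : ℝ)
    have h2 := le_abs_self (p : ℝ)
    have h3 := neg_abs_le (l : ℝ)
    have h4 := le_abs_self (l : ℝ)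
    have h5 := mul_le_mul_of_nonneg_left h1 (by linarith : 0 ≤ M - 1)
    have h6 := mul_le_mul_of_nonneg_left h2 (by linarith : 0 ≤ M - 1)
    have h8 := abs_nonneg (p : ℝ)
    have h10 := mul_nonneg hMpos.le (abs_nonneg (n : ℝ))
    have h11 := mul_nonneg (sub_nonneg.mpr hM2) (abs_nonneg (l : ℝ))
    have h12 := mul_nonneg hMpos.le (abs_nonneg (p : ℝ))
    have h13 := abs_nonneg (l : ℝ)
    rw [abs_le]
    constructor <;> nlinarith
  · obtain ⟨n, p, l⟩ := i
    simp only [id] at h0 ⊢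
    have e : ((2 * h + 1 : ℝ)) = M - 1 := by rw [hM]; ring
    rw [e]
    have h1 := neg_abs_le (n : ℝ)
    have h2 := le_abs_self (n : ℝ)
    have h3 := neg_abs_le (l : ℝ)
    have h4 := le_abs_self (l : ℝ)
    have h5 := mul_le_mul_of_nonneg_left h1 (by linarith : 0 ≤ M - 1)
    have h6 := mul_le_mul_of_nonneg_left h2 (by linarith : 0 ≤ M - 1)
    have h8 := abs_nonneg (n : ℝ)
    have h10 := mul_nonneg hMpos.le (abs_nonneg (n : ℝ))
    have h11 := mul_nonneg (sub_nonneg.mpr hM2) (abs_nonneg (l : ℝ))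
    have h12 := mul_nonneg hMpos.le (abs_nonneg (p : ℝ))
    have h13 := abs_nonneg (l : ℝ)
    rw [abs_le]
    constructor <;> nlinarith

/-! ### Cancellation of the poles -/

/-- A one-dimensional Gaussian series converges. -/
lemma summable_expo_quadratic {τ : ℂ} (hτ : 0 < τ.im) (v u : ℂ) {s : ℤ → ℂ} (hs : ∀ n, ‖s n‖ ≤ 1)
    {α : ℝ} (hα : 0 < α) (β β' γ γ' δ δ' : ℝ) :
    Summable fun n : ℤ => s n * expo τ v u (α * (n : ℝ) ^ 2 + β * n + β') (γ * n + γ')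
      (δ * n + δ') := by
  have hlin (a b : ℝ) (n : ℤ) : |a * n + b| ≤ |a| * |(n : ℝ)| + |b| := by
    rw [← abs_mul]; exact abs_add_le _ _
  refine summable_expo hτ v u (φ := fun n : ℤ => (n, 0, 0)) (fun a b h => (Prod.mk.inj h).1)
    (s := s) (ε := α) (c := |β| + |β'| + |γ| + |γ'| + |δ| + |δ'|) (b := 0) (fun k => rfl) hα
    (fun k => by simpa using hs k) (fun k _ => ?_) (fun k _ => ?_) fun k _ => ?_
  · have h1 := neg_abs_le (β * k + β')
    have h2 := hlin β β' k
    simp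
    nlinarith [mul_nonneg (abs_nonneg β') (abs_nonneg (k : ℝ)),
      mul_nonneg (abs_nonneg γ) (abs_nonneg (k : ℝ)), abs_nonneg β, abs_nonneg γ, abs_nonneg γ',
      mul_nonneg (abs_nonneg γ') (abs_nonneg (k : ℝ)), abs_nonneg δ, abs_nonneg δ',
      mul_nonneg (abs_nonneg δ) (abs_nonneg (k : ℝ)),
      mul_nonneg (abs_nonneg δ') (abs_nonneg (k : ℝ))]
  · refine (hlin γ γ' k).trans ?_
    simp
    nlinarith [mul_nonneg (abs_nonneg β') (abs_nonneg (k : ℝ)),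
      mul_nonneg (abs_nonneg β) (abs_nonneg (k : ℝ)), abs_nonneg β, abs_nonneg γ, abs_nonneg β',
      mul_nonneg (abs_nonneg γ') (abs_nonneg (k : ℝ)), abs_nonneg δ, abs_nonneg δ',
      mul_nonneg (abs_nonneg δ) (abs_nonneg (k : ℝ)),
      mul_nonneg (abs_nonneg δ') (abs_nonneg (k : ℝ))]
  · refine (hlin δ δ' k).trans ?_
    simp
    nlinarith [mul_nonneg (abs_nonneg β') (abs_nonneg (k : ℝ)),
      mul_nonneg (abs_nonneg β) (abs_nonneg (k : ℝ)), abs_nonneg β, abs_nonneg γ, abs_nonneg β',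
      mul_nonneg (abs_nonneg γ') (abs_nonneg (k : ℝ)), abs_nonneg δ, abs_nonneg γ',
      mul_nonneg (abs_nonneg γ) (abs_nonneg (k : ℝ)),
      mul_nonneg (abs_nonneg δ') (abs_nonneg (k : ℝ))]

/-- As `n → ±∞` the exponential tends to `0` or to infinity, so all but finitely many denominators
have modulus at least `1/2`. -/
lemma summable_div_one_sub_expo {τ : ℂ} (hτ : 0 < τ.im) (v u : ℂ) {f : ℤ → ℂ} (hf : Summable f) :
    Summable fun n : ℤ => f n / (1 - expo τ v u (2 * n) 1 1) := by
  refine Summable.of_norm_bounded_eventually (hf.norm.mul_left 2) ?_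
  obtain ⟨K, hK⟩ := exists_nat_gt ((1 + 2 * π * |v.im + u.im|) / (4 * π * τ.im))
  rw [div_lt_iff₀ (by positivity)] at hK
  rw [Filter.eventually_cofinite]
  refine (Set.finite_Icc (-(K : ℤ)) K).subset fun n hn => ?_
  by_contra hn2
  apply hn
  have h1 : 1 / 2 ≤ ‖1 - expo τ v u (2 * n) 1 1‖ := by
    set x := 2 * π * (2 * n * τ.im + 1 * v.im + 1 * u.im) with hx
    have hnorm : ‖expo τ v u (2 * n) 1 1‖ = Real.exp (-x) := norm_expo _ _ _ _ _ _
    have h2 := Real.exp_one_gt_d9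
    have hb := mul_le_mul_of_nonneg_left (neg_abs_le (v.im + u.im)) Real.pi_pos.le
    have hb' := mul_le_mul_of_nonneg_left (le_abs_self (v.im + u.im)) Real.pi_pos.le
    have hc : 0 < 4 * π * τ.im := by positivity
    rw [Set.mem_Icc, not_and_or, not_le, not_le] at hn2
    rcases hn2 with h | h
    · have h' : (n : ℝ) < -K := by exact_mod_cast h
      have hx1 : 1 ≤ -x := by rw [hx]; nlinarith
      have h3 : 2 ≤ ‖expo τ v u (2 * n) 1 1‖ := by
        rw [hnorm]; linarith [Real.exp_le_exp.mpr hx1]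
      have h4 := norm_sub_norm_le (expo τ v u (2 * n) 1 1) 1
      rw [norm_one, norm_sub_rev] at h4
      linarith
    · have h' : (K : ℝ) < n := by exact_mod_cast h
      have hx1 : 1 ≤ x := by rw [hx]; nlinarith
      have h3 : ‖expo τ v u (2 * n) 1 1‖ ≤ 1 / 2 := by
        rw [hnorm, Real.exp_neg, one_div]
        exact inv_anti₀ (by norm_num) (by linarith [Real.exp_le_exp.mpr hx1])
      have h4 := norm_sub_norm_le 1 (expo τ v u (2 * n) 1 1)
      rw [norm_one] at h4
      linarith
  rw [norm_div, div_le_iff₀ (by linarith)]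
  nlinarith [norm_nonneg (f n)]

/-- The theta series `θ⁽⁻⁾_{-N,N+1}` in the variable `z₁ - z₂`, up to an elementary factor. -/
def thetaT (h : ℕ) (τ v u : ℂ) : ℂ :=
  ∑' p : ℤ, (-1) ^ p * expo τ v u ((2 * h + 1) * ((p : ℝ) + 1 / 2) ^ 2 + (p : ℝ) ^ 2)
    (-((2 * h + 1) * ((p : ℝ) + 1 / 2))) 0

/-- The theta series `θ⁽⁻⁾_{N,N+1}` at the argument of the `ϑ₁₁`-term, up to an elementary
factor. -/
def thetaB (h : ℕ) (τ v u : ℂ) : ℂ :=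
  ∑' p : ℤ, (-1) ^ p * expo τ v u ((2 * h + 1) * ((p : ℝ) + 1 / 2) ^ 2 + (p : ℝ) ^ 2)
    p ((2 * h + 2) * ((p : ℝ) + 1 / 2) - 1 / 2)

/-- The first half of `Φ^[N/2,0]`. -/
def appell (h : ℕ) (τ v u : ℂ) : ℂ :=
  ∑' n : ℤ, expo τ v u ((2 * h + 1) * (n : ℝ) ^ 2) 0 ((2 * h + 1) * n) /
    (1 - expo τ v u (2 * n) 1 1)

/-- The partial fraction series of `-i η (2 τ) ^ 3 / ϑ₁₁ (2 τ, v + u)`. -/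
def poleSum (τ v u : ℂ) : ℂ :=
  ∑' n : ℤ, (-1) ^ n * expo τ v u ((n : ℝ) ^ 2 + n) (1 / 2) (1 / 2) /
    (1 - expo τ v u (2 * n) 1 1)

theorem thetaT_mul_appell_sub {h : ℕ} {τ v u : ℂ} (hτ : 0 < τ.im)
    (hw : ∀ n : ℤ, expo τ v u (2 * n) 1 1 ≠ 1) :
    thetaT h τ v u * appell h τ v u - thetaB h τ v u * poleSum τ v u =
      ∑' i, tripleTerm h τ v u i := by
  have sT : Summable fun p : ℤ => (-1 : ℂ) ^ p *
      expo τ v u ((2 * h + 1) * ((p : ℝ) + 1 / 2) ^ 2 + (p : ℝ) ^ 2)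
        (-((2 * h + 1) * ((p : ℝ) + 1 / 2))) 0 := by
    refine (summable_expo_quadratic hτ v u (s := fun n => (-1) ^ n) (fun n => by simp)
      (α := 2 * h + 2) (by positivity) (2 * h + 1) ((2 * h + 1) / 4) (-(2 * h + 1))
      (-((2 * h + 1) / 2)) 0 0).congr fun n => ?_
    congr 2 <;> ring
  have sB : Summable fun p : ℤ => (-1 : ℂ) ^ p *
      expo τ v u ((2 * h + 1) * ((p : ℝ) + 1 / 2) ^ 2 + (p : ℝ) ^ 2)
        p ((2 * h + 2) * ((p : ℝ) + 1 / 2) - 1 / 2) := by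
    refine (summable_expo_quadratic hτ v u (s := fun n => (-1) ^ n) (fun n => by simp)
      (α := 2 * h + 2) (by positivity) (2 * h + 1) ((2 * h + 1) / 4) 1 0 (2 * h + 2)
      (h + 1 / 2)).congr fun n => ?_
    congr 2 <;> ring
  have sφ : Summable fun n : ℤ => expo τ v u ((2 * h + 1) * (n : ℝ) ^ 2) 0 ((2 * h + 1) * n) /
      (1 - expo τ v u (2 * n) 1 1) := by
    refine summable_div_one_sub_expo hτ v u ?_
    refine (summable_expo_quadratic hτ v u (s := fun n => 1) (fun n => by simp)
      (α := 2 * h + 1) (by positivity) 0 0 0 0 (2 * h + 1) 0).congr fun n => ?_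
    rw [one_mul]; congr 1 <;> ring
  have sα : Summable fun n : ℤ => (-1 : ℂ) ^ n * expo τ v u ((n : ℝ) ^ 2 + n) (1 / 2) (1 / 2) /
      (1 - expo τ v u (2 * n) 1 1) := by
    refine summable_div_one_sub_expo hτ v u ?_
    refine (summable_expo_quadratic hτ v u (s := fun n => (-1) ^ n) (fun n => by simp)
      (α := 1) (by positivity) 1 0 0 (1 / 2) 0 (1 / 2)).congr fun n => ?_
    congr 2 <;> ring
  have hs := summable_tripleTerm h hτ v u
  rw [appell, poleSum, ← tsum_mul_left, ← tsum_mul_left,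
    ← (sφ.mul_left _).tsum_sub (sα.mul_left _), hs.tsum_prod]
  refine tsum_congr fun n => ?_
  rw [(hs.prod_factor n).tsum_prod]
  set Y := expo τ v u (2 * n) 1 1 with hY
  have hY1 : 1 - Y ≠ 0 := sub_ne_zero.mpr (hw n).symm
  -- After the shift `p ↦ p + n`, each term of the pole series product equals the matching term of
  -- `T A` times `Y^a`, `a = (2h+2)p + (h+1) + n`; the difference then contains `(1 - Y^a)/(1 - Y)`.
  have hpt (p : ℤ) : (-1 : ℂ) ^ (p + n) * expo τ v u
        ((2 * h + 1) * (((p + n : ℤ) : ℝ) + 1 / 2) ^ 2 + ((p + n : ℤ) : ℝ) ^ 2)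
        (p + n : ℤ) ((2 * h + 2) * (((p + n : ℤ) : ℝ) + 1 / 2) - 1 / 2) *
        ((-1) ^ n * expo τ v u ((n : ℝ) ^ 2 + n) (1 / 2) (1 / 2)) =
      (-1) ^ p * expo τ v u ((2 * h + 1) * ((p : ℝ) + 1 / 2) ^ 2 + (p : ℝ) ^ 2)
        (-((2 * h + 1) * ((p : ℝ) + 1 / 2))) 0 *
        (expo τ v u ((2 * h + 1) * (n : ℝ) ^ 2) 0 ((2 * h + 1) * n) *
          Y ^ ((2 * h + 2) * p + (h + 1) + n)) := by
    rw [hY, expo_zpow, mul_mul_mul_comm, expo_mul_eq τ v u rfl rfl rfl,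
      zpow_add₀ (by norm_num), mul_assoc ((-1 : ℂ) ^ p), neg_one_zpow_mul_self, mul_one,
      mul_assoc ((-1 : ℂ) ^ p),
      expo_mul_eq τ v u rfl rfl rfl, expo_mul_eq τ v u rfl rfl rfl]
    congr 2 <;> push_cast <;> ring
  have hB : thetaB h τ v u * ((-1) ^ n * expo τ v u ((n : ℝ) ^ 2 + n) (1 / 2) (1 / 2)) =
      ∑' p : ℤ, (-1) ^ p * expo τ v u ((2 * h + 1) * ((p : ℝ) + 1 / 2) ^ 2 + (p : ℝ) ^ 2)
        (-((2 * h + 1) * ((p : ℝ) + 1 / 2))) 0 *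
        (expo τ v u ((2 * h + 1) * (n : ℝ) ^ 2) 0 ((2 * h + 1) * n) *
          Y ^ ((2 * h + 2) * p + (h + 1) + n)) := by
    rw [thetaB, ← tsum_mul_right, ← (Equiv.addRight n).tsum_eq]
    exact tsum_congr hpt
  have sB' := (((Equiv.addRight n).summable_iff.mpr sB).mul_right
    ((-1) ^ n * expo τ v u ((n : ℝ) ^ 2 + n) (1 / 2) (1 / 2))).congr hpt
  rw [mul_div_assoc', mul_div_assoc', ← sub_div, hB, thetaT, ← tsum_mul_right,
    ← (sT.mul_right _).tsum_sub sB', ← tsum_div_const]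
  refine tsum_congr fun p => ?_
  have hg := (hasSum_sgnInd_mul_zpow (expo_ne_zero τ v u (2 * n) 1 1) (hw n)
    ((2 * h + 2) * p + (h + 1) + n)).tsum_eq
  rw [← hY] at hg
  rw [← mul_sub, ← mul_one_sub, mul_div_assoc, mul_div_assoc, ← hg, ← tsum_mul_left,
    ← tsum_mul_left]
  refine tsum_congr fun l => ?_
  rw [tripleTerm, hY, expo_zpow]
  have e : expo τ v u ((2 * h + 1) * ((p : ℝ) + 1 / 2) ^ 2 + (p : ℝ) ^ 2)
        (-((2 * h + 1) * ((p : ℝ) + 1 / 2))) 0 *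
      (expo τ v u ((2 * h + 1) * (n : ℝ) ^ 2) 0 ((2 * h + 1) * n) *
        expo τ v u (l * (2 * n)) (l * 1) (l * 1)) =
      expo τ v u ((2 * h + 1) * (n : ℝ) ^ 2 + (2 * h + 1) * ((p : ℝ) + 1 / 2) ^ 2 +
        (p : ℝ) ^ 2 + 2 * n * l) (l - (2 * h + 1) * ((p : ℝ) + 1 / 2))
        ((2 * h + 1) * n + l) := by
    rw [expo_mul_eq τ v u rfl rfl rfl, expo_mul_eq τ v u rfl rfl rfl]
    congr 1 <;> ring
  simp only
  rw [← e]
  ring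

/-! ### Periodic coefficients and theta decomposition -/

/-- The summands of the coefficients of the indefinite theta series, up to a sign factor. -/
def coeffTerm (h : ℕ) (τ v : ℂ) (p l : ℤ) : ℂ :=
  (-1) ^ p * expo τ v 0 ((2 * h + 1) * ((p : ℝ) + 1 / 2) ^ 2 + (p : ℝ) ^ 2 -
    (l : ℝ) ^ 2 / (2 * h + 1)) (l - (2 * h + 1) * ((p : ℝ) + 1 / 2)) 0

/-- The exponentials appearing in the theta functions of degree `N / 2`, `N = 2 h + 1`. -/
def thetaTerm (h : ℕ) (τ u : ℂ) (L : ℤ) : ℂ := expo τ 0 u ((L : ℝ) ^ 2 / (2 * h + 1)) 0 L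

/-- The summands of `indefCoeff`. -/
def indefTerm (h : ℕ) (τ v : ℂ) (L : ℤ) (i : ℤ × ℤ) : ℂ :=
  sgnInd ((2 * h + 1) * i.2 + L) ((2 * h + 2) * i.1 + (h + 1) - i.2) *
    coeffTerm h τ v i.1 ((2 * h + 1) * i.2 + L)

/-- The coefficients of the indefinite theta series. -/
def indefCoeff (h : ℕ) (τ v : ℂ) (L : ℤ) : ℂ := ∑' i, indefTerm h τ v L i

lemma expo_mul_expo_zero (τ v u : ℂ) (x y x' w : ℝ) :
    expo τ v 0 x y 0 * expo τ 0 u x' 0 w = expo τ v u (x + x') y w := by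
  simp only [expo, ← Complex.exp_add]
  congr 1
  push_cast
  ring

/-- The change of summation indices. -/
def indexEquiv (h : ℕ) : ℤ × ℤ × ℤ ≃ ℤ × ℤ × ℤ where
  toFun i := (-i.2.2, i.2.1, (2 * h + 1) * i.2.2 + i.1)
  invFun i := ((2 * h + 1) * i.1 + i.2.2, i.2.1, -i.1)
  left_inv i := by ext <;> simp
  right_inv i := by ext <;> simp

/-- With `N = 2h+1`, `n = -r` and `L = Nn + l`, completing the square gives `Nn² + 2nl = L²/N -
l²/N`, which separates `u` from `v`. -/
lemma tripleTerm_indexEquiv (h : ℕ) (τ v u : ℂ) (i : ℤ × ℤ × ℤ) :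
    tripleTerm h τ v u (indexEquiv h i) = indefTerm h τ v i.1 i.2 * thetaTerm h τ u i.1 := by
  have hN : (2 * (h : ℝ) + 1) ≠ 0 := by positivity
  obtain ⟨L, p, r⟩ := i
  simp only [tripleTerm, indexEquiv, Equiv.coe_fn_mk, indefTerm, thetaTerm, coeffTerm]
  rw [← mul_assoc, mul_assoc _ (expo _ _ _ _ _ _), expo_mul_expo_zero, ← sub_eq_add_neg]
  congr 2
  · push_cast; field_simp; ring
  · push_cast; ring

lemma summable_indef_prod (h : ℕ) {τ : ℂ} (hτ : 0 < τ.im) (v u : ℂ) :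
    Summable fun i : ℤ × ℤ × ℤ => indefTerm h τ v i.1 i.2 * thetaTerm h τ u i.1 :=
  ((indexEquiv h).summable_iff.mpr (summable_tripleTerm h hτ v u)).congr
    (tripleTerm_indexEquiv h τ v u)

lemma thetaTerm_ne_zero (h : ℕ) (τ u : ℂ) (L : ℤ) : thetaTerm h τ u L ≠ 0 := expo_ne_zero _ _ _ _ _ _

lemma summable_indefTerm (h : ℕ) {τ : ℂ} (hτ : 0 < τ.im) (v : ℂ) (L : ℤ) :
    Summable (indefTerm h τ v L) :=
  (summable_mul_right_iff (thetaTerm_ne_zero h τ 0 L)).mp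
    ((summable_indef_prod h hτ v 0).prod_factor L)

lemma summable_indefCoeff_mul (h : ℕ) {τ : ℂ} (hτ : 0 < τ.im) (v u : ℂ) :
    Summable fun L => indefCoeff h τ v L * thetaTerm h τ u L := by
  refine (summable_indef_prod h hτ v u).prod.congr fun L => ?_
  exact tsum_mul_right (f := indefTerm h τ v L) (a := thetaTerm h τ u L)

lemma tsum_tripleTerm (h : ℕ) {τ : ℂ} (hτ : 0 < τ.im) (v u : ℂ) :
    ∑' i, tripleTerm h τ v u i = ∑' L, indefCoeff h τ v L * thetaTerm h τ u L := by
  rw [← (indexEquiv h).tsum_eq, tsum_congr (tripleTerm_indexEquiv h τ v u),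
    (summable_indef_prod h hτ v u).tsum_prod]
  refine tsum_congr fun L => ?_
  exact tsum_mul_right (f := indefTerm h τ v L) (a := thetaTerm h τ u L)

/-- The involution showing that the coefficients are periodic. -/
def reflectEquiv : ℤ × ℤ ≃ ℤ × ℤ where
  toFun i := (i.1 - 2 * i.2 + 1, 1 - i.2)
  invFun i := (i.1 - 2 * i.2 + 1, 1 - i.2)
  left_inv i := by ext <;> simp; ring
  right_inv i := by ext <;> simp; ring

/-- The involution `(p, r) ↦ (p - 2r + 1, 1 - r)` preserves the boundary line, on which `p - r` is
fixed, and the exponents there, but reverses `(-1)^p`. -/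
lemma tsum_ite_coeffTerm (h : ℕ) (τ v : ℂ) (L : ℤ) :
    ∑' i : ℤ × ℤ, (if (2 * h + 1) * i.2 + L = (2 * h + 2) * i.1 + (h + 1) - i.2 then (1 : ℂ) else 0) *
      coeffTerm h τ v i.1 ((2 * h + 1) * i.2 + L) = 0 := by
  rw [← self_eq_neg]
  conv_lhs => rw [← reflectEquiv.tsum_eq]
  rw [← tsum_neg]
  refine tsum_congr fun i => ?_
  obtain ⟨p, r⟩ := i
  change (if (2 * h + 1) * (1 - r) + L = (2 * h + 2) * (p - 2 * r + 1) + (h + 1) - (1 - r)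
    then (1 : ℂ) else 0) * coeffTerm h τ v (p - 2 * r + 1) ((2 * h + 1) * (1 - r) + L) =
    -((if (2 * h + 1) * r + L = (2 * h + 2) * p + (h + 1) - r then (1 : ℂ) else 0) *
      coeffTerm h τ v p ((2 * h + 1) * r + L))
  by_cases hc : (2 * h + 1) * r + L = (2 * h + 2) * p + (h + 1) - r
  · rw [if_pos hc, if_pos (by linear_combination hc), one_mul, one_mul, coeffTerm, coeffTerm]
    have hL : L = (2 * h + 2) * (p - r) + (h + 1) := by linear_combination hc
    have hN : (2 * (h : ℝ) + 1) ≠ 0 := by positivity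
    rw [← neg_mul]
    congr 1
    · rw [neg_one_zpow_add_one, neg_one_zpow_sub, zpow_mul]; norm_num
    · subst hL
      congr 1 <;> push_cast
      · field_simp; ring
      · ring
  · rw [if_neg hc, if_neg (fun h' => hc (by linear_combination h')), zero_mul, zero_mul, neg_zero]

theorem indefCoeff_add_period (h : ℕ) {τ : ℂ} (hτ : 0 < τ.im) (v : ℂ) (L : ℤ) :
    indefCoeff h τ v (L + (2 * h + 1)) = indefCoeff h τ v L := by
  -- Replacing `r` by `r - 1` absorbs the shift of `L` in `l`; only the endpoint of the interval
  -- moves, by one.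
  have e (i : ℤ × ℤ) :
      indefTerm h τ v (L + (2 * h + 1)) (((Equiv.refl ℤ).prodCongr (Equiv.subRight 1)) i) =
      indefTerm h τ v L i +
      (if (2 * h + 1) * i.2 + L = (2 * h + 2) * i.1 + (h + 1) - i.2 then (1 : ℂ) else 0) *
      coeffTerm h τ v i.1 ((2 * h + 1) * i.2 + L) := by
    obtain ⟨p, r⟩ := i
    simp only [indefTerm, Equiv.prodCongr_apply, Prod.map_apply, Equiv.refl_apply,
      Equiv.subRight_apply]
    rw [← add_mul, ← sgnInd_succ]
    congr 2 <;> ring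
  have hs := summable_indefTerm h hτ v L
  have hs2 := (((Equiv.refl ℤ).prodCongr (Equiv.subRight 1)).summable_iff.mpr
    (summable_indefTerm h hτ v (L + (2 * h + 1))))
  have hs3 := (hs2.sub hs).congr (fun i => by rw [Function.comp_apply, e, add_sub_cancel_left])
  rw [indefCoeff, ← ((Equiv.refl ℤ).prodCongr (Equiv.subRight 1)).tsum_eq, tsum_congr e,
    hs.tsum_add hs3, tsum_ite_coeffTerm, add_zero, indefCoeff]

lemma indefCoeff_add_mul_period (h : ℕ) {τ : ℂ} (hτ : 0 < τ.im) (v : ℂ) (L j : ℤ) :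
    indefCoeff h τ v (L + j * (2 * h + 1)) = indefCoeff h τ v L := by
  have : Function.Periodic (indefCoeff h τ v) (2 * h + 1) := indefCoeff_add_period h hτ v
  simpa using this.int_mul j L

lemma thetaTerm_neg (h : ℕ) (τ u : ℂ) (L : ℤ) : thetaTerm h τ (-u) L = thetaTerm h τ u (-L) := by
  simp [thetaTerm, expo]

/-- The theta series of degree `N / 2`, `N = 2 h + 1`. -/
def thetaSum (h : ℕ) (τ u : ℂ) (k : ℤ) : ℂ := ∑' j : ℤ, thetaTerm h τ u (k + j * (2 * h + 1))

lemma thetaSum_add_period (h : ℕ) (τ u : ℂ) (k : ℤ) :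
    thetaSum h τ u (k + (2 * h + 1)) = thetaSum h τ u k := by
  rw [thetaSum, thetaSum, ← (Equiv.subRight (1 : ℤ)).tsum_eq]
  refine tsum_congr fun j => ?_
  rw [Equiv.subRight_apply]
  congr 1; ring

/-- The part of `indefCoeff` that is odd in the index. -/
def oddCoeff (h : ℕ) (τ v : ℂ) (L : ℤ) : ℂ := indefCoeff h τ v L - indefCoeff h τ v (-L)

lemma tsum_int_eq_sum_tsum (n : ℕ) [NeZero n] {f : ℤ → ℂ} (hf : Summable f) :
    ∑' L, f L = ∑ k ∈ Finset.range n, ∑' j : ℤ, f (k + j * n) := by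
  set e : Fin n × ℤ ≃ ℤ := (Equiv.prodComm (Fin n) ℤ).trans (Int.divModEquiv n).symm
  have hs : Summable fun i => f (e i) := e.summable_iff.mpr hf
  rw [← e.tsum_eq, hs.tsum_prod, tsum_fintype, Finset.sum_range]
  refine Finset.sum_congr rfl fun k _ => tsum_congr fun j => ?_
  exact congrArg f (add_comm _ _)

/-- The antisymmetrized indefinite theta series is a combination of theta functions. -/
theorem tsum_tripleTerm_sub (h : ℕ) {τ : ℂ} (hτ : 0 < τ.im) (v u : ℂ) :
    ∑' i, tripleTerm h τ v u i - ∑' i, tripleTerm h τ v (-u) i =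
      ∑ k ∈ Finset.range (h + 1), oddCoeff h τ v k * (thetaSum h τ u k - thetaSum h τ u (-k)) := by
  have hs := summable_indefCoeff_mul h hτ v u
  have hs' : Summable fun L => indefCoeff h τ v (-L) * thetaTerm h τ u L := by
    refine ((Equiv.neg ℤ).summable_iff.mpr (summable_indefCoeff_mul h hτ v (-u))).congr fun L => ?_
    simp [thetaTerm_neg]
  have h1 : ∑' i, tripleTerm h τ v (-u) i = ∑' L, indefCoeff h τ v (-L) * thetaTerm h τ u L := by
    rw [tsum_tripleTerm h hτ, ← (Equiv.neg ℤ).tsum_eq]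
    refine tsum_congr fun L => ?_
    simp [thetaTerm_neg]
  have hs2 : Summable fun L => oddCoeff h τ v L * thetaTerm h τ u L :=
    (hs.sub hs').congr fun L => by rw [oddCoeff, sub_mul]
  have hper (k : ℤ) (j : ℤ) : oddCoeff h τ v (k + j * (2 * h + 1)) = oddCoeff h τ v k := by
    rw [oddCoeff, oddCoeff, indefCoeff_add_mul_period h hτ,
      show -(k + j * (2 * h + 1)) = -k + (-j) * (2 * (h : ℤ) + 1) by ring,
      indefCoeff_add_mul_period h hτ]
  have h2 : ∑' L, oddCoeff h τ v L * thetaTerm h τ u L =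
      ∑ k ∈ Finset.range (2 * h + 1), oddCoeff h τ v k * thetaSum h τ u k := by
    rw [tsum_int_eq_sum_tsum (2 * h + 1) hs2]
    refine Finset.sum_congr rfl fun k _ => ?_
    rw [thetaSum, ← tsum_mul_left]
    refine tsum_congr fun j => ?_
    push_cast
    rw [hper]
  have h0 : oddCoeff h τ v 0 = 0 := by simp [oddCoeff]
  rw [h1, tsum_tripleTerm h hτ, ← hs.tsum_sub hs',
    tsum_congr (fun L => (sub_mul (indefCoeff h τ v L) (indefCoeff h τ v (-L))
      (thetaTerm h τ u L)).symm)]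
  change ∑' L, oddCoeff h τ v L * thetaTerm h τ u L = _
  -- The residues `h+1, …, 2h` are folded onto `-h, …, -1`, where the odd coefficient changes sign.
  rw [h2, Finset.sum_range_succ', Finset.sum_range_succ' _ h, two_mul, Finset.sum_range_add,
    ← Finset.sum_range_reflect (fun k => oddCoeff h τ v ((h + k + 1 : ℕ) : ℤ) * _),
    ← Finset.sum_add_distrib]
  congr 1
  · refine Finset.sum_congr rfl fun k hk => ?_
    have hk' := Finset.mem_range.mp hk
    have e : ((h + (h - 1 - k) + 1 : ℕ) : ℤ) = -((k + 1 : ℕ) : ℤ) + 1 * (2 * h + 1) := by omega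
    rw [e, hper, one_mul, thetaSum_add_period]
    have e2 : oddCoeff h τ v (-((k + 1 : ℕ) : ℤ)) = -oddCoeff h τ v ((k + 1 : ℕ) : ℤ) := by
      simp [oddCoeff]
    rw [e2]; ring
  · simp [h0]

/-! ### Evaluation of the coefficients by lattice sectors -/

/-- When `|r| ≤ |p|`, `Np²` absorbs `Nr²`, and the remaining `p²` is at least `(p² + r²)/2`, whence
`ε = 1/2`. -/
lemma summable_ite_coeffTerm (h : ℕ) {τ : ℂ} (hτ : 0 < τ.im) (v : ℂ) (K : ℤ)
    (P : ℤ × ℤ → Prop) [DecidablePred P] (hP : ∀ i, P i → |i.2| ≤ |i.1|) :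
    Summable fun i : ℤ × ℤ => if P i then coeffTerm h τ v i.1 ((2 * h + 1) * i.2 + K) else 0 := by
  have hN : (0 : ℝ) < 2 * h + 1 := by positivity
  have hN1 : (1 : ℝ) ≤ 2 * h + 1 := by linarith [(Nat.cast_nonneg h : (0 : ℝ) ≤ h)]
  set N : ℝ := 2 * h + 1 with hNdef
  refine summable_expo hτ v 0 (φ := fun i : ℤ × ℤ => (i.1, i.2, 0))
    (fun a b h => by simpa [Prod.ext_iff] using h)
    (s := fun i => if P i then (-1) ^ i.1 else 0)
    (X := fun i => N * ((i.1 : ℝ) + 1 / 2) ^ 2 + (i.1 : ℝ) ^ 2 - (N * i.2 + K) ^ 2 / N)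
    (Y := fun i => N * i.2 + K - N * ((i.1 : ℝ) + 1 / 2))
    (W := fun _ => 0) (ε := 1 / 2) (c := N + 2 * |(K : ℝ)| + (K : ℝ) ^ 2) (b := 0)
    (fun i => ?_) (by norm_num) (fun i => ?_) (fun i h0 => ?_) (fun i h0 => ?_) fun i _ => ?_
  · split_ifs
    · rw [coeffTerm]; push_cast; rfl
    · simp
  · split_ifs <;> simp
  · have hi : P i := by by_contra h; simp [h] at h0
    have h1 : |(i.2 : ℝ)| ≤ |(i.1 : ℝ)| := by exact_mod_cast hP i hi
    have h2 := pow_le_pow_left₀ (abs_nonneg _) h1 2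
    rw [sq_abs, sq_abs] at h2
    have h3 : (N * (i.2 : ℝ) + K) ^ 2 / N = N * (i.2 : ℝ) ^ 2 + 2 * (i.2 * K) + K ^ 2 / N := by
      field_simp; ring
    have h4 : (K : ℝ) ^ 2 / N ≤ (K : ℝ) ^ 2 := div_le_self (sq_nonneg _) hN1
    have h5 := le_abs_self ((i.2 : ℝ) * K)
    rw [abs_mul] at h5
    have h6 := neg_abs_le (i.1 : ℝ)
    rw [h3]
    simp
    have h7 := mul_nonneg hN.le (sub_nonneg.mpr h2)
    have h8 := mul_le_mul_of_nonneg_left h6 hN.le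
    have h9 := mul_nonneg (abs_nonneg (K : ℝ)) (abs_nonneg (i.1 : ℝ))
    have h10 := mul_nonneg (sq_nonneg (K : ℝ)) (abs_nonneg (i.1 : ℝ))
    have h11 := mul_nonneg (sq_nonneg (K : ℝ)) (abs_nonneg (i.2 : ℝ))
    have h12 := mul_nonneg hN.le (abs_nonneg (i.2 : ℝ))
    have h13 := abs_nonneg (K : ℝ)
    nlinarith
  · have h1 : |N * (i.2 : ℝ) + K - N * ((i.1 : ℝ) + 1 / 2)| ≤
        N * |(i.2 : ℝ)| + |(K : ℝ)| + N * (|(i.1 : ℝ)| + 1 / 2) := by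
      refine (abs_sub _ _).trans (add_le_add ((abs_add_le _ _).trans ?_) ?_)
      · rw [abs_mul, abs_of_pos hN]
      · rw [abs_mul, abs_of_pos hN]
        refine mul_le_mul_of_nonneg_left ((abs_add_le _ _).trans ?_) hN.le
        norm_num
    refine h1.trans ?_
    simp
    have h9 := mul_nonneg (abs_nonneg (K : ℝ)) (abs_nonneg (i.1 : ℝ))
    have h10 := mul_nonneg (sq_nonneg (K : ℝ)) (abs_nonneg (i.1 : ℝ))
    have h11 := mul_nonneg (sq_nonneg (K : ℝ)) (abs_nonneg (i.2 : ℝ))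
    have h12 := mul_nonneg (abs_nonneg (K : ℝ)) (abs_nonneg (i.2 : ℝ))
    have h13 := abs_nonneg (K : ℝ)
    nlinarith [sq_nonneg (K : ℝ)]
  · simp; positivity

/-- Summation over the region `p < r ≤ 0` by rows. -/
lemma hasSum_lower {G : ℤ → ℤ → ℂ}
    (hG : Summable fun i : ℤ × ℤ => if i.1 < i.2 ∧ i.2 ≤ 0 then G i.1 i.2 else 0) :
    HasSum (fun j : {j : ℕ // 1 ≤ j} => ∑ r ∈ Finset.range j, G (-(j : ℕ)) (r - (j : ℕ) + 1))
      (∑' i : ℤ × ℤ, if i.1 < i.2 ∧ i.2 ≤ 0 then G i.1 i.2 else 0) := by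
  have h1 (p : ℤ) : HasSum (fun r : ℤ => if p < r ∧ r ≤ 0 then G p r else 0)
      (∑ r ∈ Finset.Icc (p + 1) 0, G p r) := by
    have h := hasSum_sum_of_ne_finset_zero (L := .unconditional ℤ)
      (f := fun r : ℤ => if p < r ∧ r ≤ 0 then G p r else 0)
      (s := Finset.Icc (p + 1) 0) (fun r hr => if_neg fun h => hr (by
        rw [Finset.mem_Icc]; omega))
    refine hasSum_of_eq h (fun _ => rfl) (Finset.sum_congr rfl fun r hr => ?_)
    rw [Finset.mem_Icc] at hr
    rw [if_pos (by omega)]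
  have h2 := hG.hasSum.prod_fiberwise h1
  have hinj : Function.Injective fun j : {j : ℕ // 1 ≤ j} => (-((j : ℕ) : ℤ)) := fun a b hab =>
    Subtype.ext (by simpa using hab)
  refine hasSum_of_eq ((hinj.hasSum_iff fun p hp => ?_).mpr h2) (fun j => ?_) rfl
  · refine Finset.sum_eq_zero fun r hr => ?_
    rw [Finset.mem_Icc] at hr
    exact absurd ⟨⟨p.natAbs, by omega⟩, by simp only; omega⟩ hp
  · simp only [Function.comp_apply]
    refine Finset.sum_bij (fun r _ => (r : ℤ) - (j : ℕ) + 1) (fun r hr => ?_)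
      (fun a _ b _ hab => by simpa using hab) (fun r hr => ?_) fun r _ => rfl
    · rw [Finset.mem_range] at hr
      rw [Finset.mem_Icc]; omega
    · rw [Finset.mem_Icc] at hr
      exact ⟨(r + (j : ℕ) - 1).toNat, by rw [Finset.mem_range]; omega, by omega⟩

/-- Summation over the region `1 ≤ r ≤ p` by rows. -/
lemma hasSum_upper {G : ℤ → ℤ → ℂ}
    (hG : Summable fun i : ℤ × ℤ => if 1 ≤ i.2 ∧ i.2 ≤ i.1 then G i.1 i.2 else 0) :
    HasSum (fun j : {j : ℕ // 1 ≤ j} => ∑ r ∈ Finset.range j, G (j : ℕ) ((j : ℕ) - r))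
      (∑' i : ℤ × ℤ, if 1 ≤ i.2 ∧ i.2 ≤ i.1 then G i.1 i.2 else 0) := by
  have h1 (p : ℤ) : HasSum (fun r : ℤ => if 1 ≤ r ∧ r ≤ p then G p r else 0)
      (∑ r ∈ Finset.Icc 1 p, G p r) := by
    have h := hasSum_sum_of_ne_finset_zero (L := .unconditional ℤ)
      (f := fun r : ℤ => if 1 ≤ r ∧ r ≤ p then G p r else 0)
      (s := Finset.Icc 1 p) (fun r hr => if_neg fun h => hr (by
        rw [Finset.mem_Icc]; omega))
    refine hasSum_of_eq h (fun _ => rfl) (Finset.sum_congr rfl fun r hr => ?_)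
    rw [Finset.mem_Icc] at hr
    rw [if_pos (by omega)]
  have h2 := hG.hasSum.prod_fiberwise h1
  have hinj : Function.Injective fun j : {j : ℕ // 1 ≤ j} => ((j : ℕ) : ℤ) := fun a b hab =>
    Subtype.ext (by simpa using hab)
  refine hasSum_of_eq ((hinj.hasSum_iff fun p hp => ?_).mpr h2) (fun j => ?_) rfl
  · refine Finset.sum_eq_zero fun r hr => ?_
    rw [Finset.mem_Icc] at hr
    exact absurd ⟨⟨p.natAbs, by omega⟩, by simp only; omega⟩ hp
  · simp only [Function.comp_apply]
    refine Finset.sum_bij (fun r _ => ((j : ℕ) : ℤ) - r) (fun r hr => ?_)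
      (fun a _ b _ hab => by simpa using hab) (fun r hr => ?_) fun r _ => rfl
    · rw [Finset.mem_range] at hr
      rw [Finset.mem_Icc]; omega
    · rw [Finset.mem_Icc] at hr
      exact ⟨((j : ℕ) - r).toNat, by rw [Finset.mem_range]; omega, by omega⟩

/-- The upper condition reads `(2h+2)(r-p) < h+1-k`. As `0 < h+1-k < 2h+2`, this is `r ≤ p`. -/
lemma sgnInd_of_nonneg {h : ℕ} {k p r : ℤ} (hk0 : 0 ≤ k) (hk : k ≤ h) :
    sgnInd ((2 * h + 1) * r + k) ((2 * h + 2) * p + (h + 1) - r) =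
      (if 1 ≤ r ∧ r ≤ p then 1 else 0) - (if p < r ∧ r ≤ 0 then 1 else 0) +
      (if r = 0 then 1 else 0) := by
  have h1 : (2 * h + 1) * r + k < (2 * h + 2) * p + (h + 1) - r ↔ r ≤ p := by
    constructor <;> intro h' <;> nlinarith
  have h2 : (2 * h + 1) * r + k < 0 ↔ r < 0 := by
    constructor <;> intro h' <;> nlinarith
  rw [sgnInd, if_congr h1 rfl rfl, if_congr h2 rfl rfl]
  split_ifs <;> first | omega | norm_num

/-- The line `r = 0` now satisfies `l < 0`, so the extra term of `sgnInd_of_nonneg` disappears. -/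
lemma sgnInd_of_neg {h : ℕ} {k p r : ℤ} (hk0 : k < 0) (hk : -k ≤ h) :
    sgnInd ((2 * h + 1) * r + k) ((2 * h + 2) * p + (h + 1) - r) =
      (if 1 ≤ r ∧ r ≤ p then 1 else 0) - (if p < r ∧ r ≤ 0 then 1 else 0) := by
  have h1 : (2 * h + 1) * r + k < (2 * h + 2) * p + (h + 1) - r ↔ r ≤ p := by
    constructor <;> intro h' <;> nlinarith
  have h2 : (2 * h + 1) * r + k < 0 ↔ r ≤ 0 := by
    constructor <;> intro h' <;> nlinarith
  rw [sgnInd, if_congr h1 rfl rfl, if_congr h2 rfl rfl]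
  split_ifs <;> first | omega | norm_num

/-- The sum over the region `p < r ≤ 0`. -/
def lowerSum (h : ℕ) (τ v : ℂ) (K : ℤ) : ℂ :=
  ∑' i : ℤ × ℤ, if i.1 < i.2 ∧ i.2 ≤ 0 then coeffTerm h τ v i.1 ((2 * h + 1) * i.2 + K) else 0

/-- The sum over the region `1 ≤ r ≤ p`. -/
def upperSum (h : ℕ) (τ v : ℂ) (K : ℤ) : ℂ :=
  ∑' i : ℤ × ℤ, if 1 ≤ i.2 ∧ i.2 ≤ i.1 then coeffTerm h τ v i.1 ((2 * h + 1) * i.2 + K) else 0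

lemma summable_lower (h : ℕ) {τ : ℂ} (hτ : 0 < τ.im) (v : ℂ) (K : ℤ) :
    Summable fun i : ℤ × ℤ => if i.1 < i.2 ∧ i.2 ≤ 0 then
      coeffTerm h τ v i.1 ((2 * h + 1) * i.2 + K) else 0 :=
  summable_ite_coeffTerm h hτ v K (fun i => i.1 < i.2 ∧ i.2 ≤ 0) fun i hi => by
    rw [abs_of_nonpos hi.2, abs_of_neg (by omega)]; omega

lemma summable_upper (h : ℕ) {τ : ℂ} (hτ : 0 < τ.im) (v : ℂ) (K : ℤ) :
    Summable fun i : ℤ × ℤ => if 1 ≤ i.2 ∧ i.2 ≤ i.1 then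
      coeffTerm h τ v i.1 ((2 * h + 1) * i.2 + K) else 0 :=
  summable_ite_coeffTerm h hτ v K (fun i => 1 ≤ i.2 ∧ i.2 ≤ i.1) fun i hi => by
    rw [abs_of_nonneg (by omega), abs_of_nonneg (by omega)]; omega

lemma indefCoeff_of_neg {h : ℕ} {τ : ℂ} (hτ : 0 < τ.im) (v : ℂ) {k : ℤ} (hk0 : k < 0)
    (hk : -k ≤ h) : indefCoeff h τ v k = upperSum h τ v k - lowerSum h τ v k := by
  rw [indefCoeff, upperSum, lowerSum, ← (summable_upper h hτ v k).tsum_sub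
    (summable_lower h hτ v k)]
  refine tsum_congr fun i => ?_
  rw [indefTerm, sgnInd_of_neg hk0 hk, sub_mul, ite_mul, ite_mul, one_mul, zero_mul]

/-- Source of the final sum of the proposition: on `r = 0` only the factor in `p` varies, and it is
the series `thetaT`. -/
lemma thetaT_mul_expo (h : ℕ) (τ v u : ℂ) (k : ℤ) :
    ∑' i : ℤ × ℤ, (if i.2 = 0 then coeffTerm h τ v i.1 ((2 * h + 1) * i.2 + k) else 0) =
      thetaT h τ v u * expo τ v u (-((k : ℝ) ^ 2 / (2 * h + 1))) k 0 := by
  have hinj : Function.Injective fun p : ℤ => (p, (0 : ℤ)) := fun a b hab => (Prod.mk.inj hab).1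
  rw [← hinj.tsum_eq]
  · rw [thetaT, ← tsum_mul_right]
    refine tsum_congr fun p => ?_
    rw [if_pos rfl, coeffTerm, mul_assoc, expo_mul_eq τ v u rfl rfl rfl]
    congr 1
    simp only [expo]
    congr 1
    push_cast
    ring
  · intro i hi
    have : i.2 = 0 := by by_contra h; simp [h] at hi
    exact ⟨i.1, by rw [← this]⟩

lemma indefCoeff_of_nonneg {h : ℕ} {τ : ℂ} (hτ : 0 < τ.im) (v u : ℂ) {k : ℤ} (hk0 : 0 ≤ k)
    (hk : k ≤ h) : indefCoeff h τ v k = upperSum h τ v k - lowerSum h τ v k +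
      thetaT h τ v u * expo τ v u (-((k : ℝ) ^ 2 / (2 * h + 1))) k 0 := by
  have hs := summable_ite_coeffTerm h hτ v k (fun i => i.2 = 0) fun i hi => by
    rw [hi]; simp
  rw [indefCoeff, upperSum, lowerSum, ← thetaT_mul_expo, ← (summable_upper h hτ v k).tsum_sub
    (summable_lower h hτ v k), ← ((summable_upper h hτ v k).sub (summable_lower h hτ v k)).tsum_add
    hs]
  refine tsum_congr fun i => ?_
  rw [indefTerm, sgnInd_of_nonneg hk0 hk, add_mul, sub_mul, ite_mul, ite_mul, ite_mul, one_mul,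
    zero_mul]

lemma oddCoeff_eq {h : ℕ} {τ : ℂ} (hτ : 0 < τ.im) (v u : ℂ) {k : ℤ} (hk0 : 0 < k)
    (hk : k ≤ h) : oddCoeff h τ v k =
      thetaT h τ v u * expo τ v u (-((k : ℝ) ^ 2 / (2 * h + 1))) k 0 +
      (lowerSum h τ v (-k) + upperSum h τ v k) - (lowerSum h τ v k + upperSum h τ v (-k)) := by
  rw [oddCoeff, indefCoeff_of_nonneg hτ v u hk0.le hk, indefCoeff_of_neg hτ v (by omega) (by omega)]
  ring

/-! ### Translation into the functions of the statement -/

lemma natCast_two_mul_add_one_ne_zero (h : ℕ) : (2 * (h : ℂ) + 1) ≠ 0 := by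
  exact_mod_cast (by omega : 2 * h + 1 ≠ 0)

lemma natCast_two_mul_add_two_ne_zero (h : ℕ) : (2 * (h : ℂ) + 2) ≠ 0 := by
  exact_mod_cast (by omega : 2 * h + 2 ≠ 0)

lemma thetaMinus_neg_eq (h : ℕ) (τ v u : ℂ) :
    thetaMinus (-(2 * h + 1)) (2 * h + 2) τ ((2 * h + 1) * v / (2 * h + 2)) =
      expo τ v 0 (-((2 * h + 1) / (4 * (2 * h + 2)))) ((2 * h + 1) / (2 * (2 * h + 2))) 0 *
        thetaT h τ v u := by
  have hM := natCast_two_mul_add_two_ne_zero h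
  rw [thetaMinus, thetaT, ← tsum_mul_left, ← (Equiv.neg ℤ).tsum_eq]
  refine tsum_congr fun p => ?_
  rw [Equiv.neg_apply, neg_one_zpow_neg, mul_assoc, mul_left_comm (expo _ _ _ _ _ _), expo, expo, qPow,
    ← Complex.exp_add, ← Complex.exp_add]
  congr 2
  push_cast
  field_simp
  ring

lemma thetaMinus_eq (h : ℕ) (τ v u : ℂ) :
    thetaMinus (2 * h + 1) (2 * h + 2) τ (v / (2 * h + 2) + u) =
      expo τ v 0 (-((2 * h + 1) / (4 * (2 * h + 2)))) ((2 * h + 1) / (2 * (2 * h + 2))) 0 *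
        thetaB h τ v u := by
  have hM := natCast_two_mul_add_two_ne_zero h
  rw [thetaMinus, thetaB, ← tsum_mul_left]
  refine tsum_congr fun p => ?_
  rw [mul_assoc, mul_left_comm (expo _ _ _ _ _ _), expo, expo, qPow, ← Complex.exp_add, ← Complex.exp_add]
  congr 2
  push_cast
  field_simp
  ring

/-- Even indices in degree `2m` at `τ` give the same series as all indices in degree `m` at `2τ`
with doubled argument; hence the even `k` in the double sums. -/
lemma theta_two_mul_index (h : ℕ) (τ u : ℂ) (k : ℤ) :
    theta (2 * k) (2 * h + 1) τ u = thetaSum h τ u k := by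
  have hN := natCast_two_mul_add_one_ne_zero h
  refine tsum_congr fun j => ?_
  rw [thetaTerm, expo, qPow, ← Complex.exp_add]
  congr 1
  push_cast
  field_simp
  ring

lemma theta_two_mul_period (h : ℕ) (τ u : ℂ) (k : ℤ) :
    theta k ((2 * h + 1) / 2) (2 * τ) (2 * u) = thetaSum h τ u k := by
  have hN := natCast_two_mul_add_one_ne_zero h
  refine tsum_congr fun j => ?_
  rw [thetaTerm, expo, qPow, ← Complex.exp_add]
  congr 1
  push_cast
  field_simp
  ring

lemma Phi_eq_appell_sub (h : ℕ) (τ z₁ z₂ : ℂ) :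
    Phi ((2 * h + 1) / 2) 0 (2 * τ) (2 * z₁) (2 * z₂) 0 =
      appell h τ (z₁ - z₂) (z₁ + z₂) - appell h τ (z₁ - z₂) (-(z₁ + z₂)) := by
  rw [Phi, Phi1, Phi2, mul_zero, Complex.exp_zero, one_mul, one_mul, appell, appell]
  congr 1 <;> refine tsum_congr fun j => ?_
  all_goals
    rw [expo, expo, qPow, qPow, ← Complex.exp_add, ← Complex.exp_add]
    congr 3 <;> push_cast <;> ring

lemma vartheta11_neg (τ w : ℂ) : vartheta11 (2 * τ) (-w) = -vartheta11 (2 * τ) w := by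
  rw [vartheta11_two_mul, vartheta11_two_mul, ← mul_neg, ← tsum_neg,
    ← (Equiv.subLeft (-1 : ℤ)).tsum_eq]
  congr 1
  refine tsum_congr fun k => ?_
  rw [Equiv.subLeft_apply, thetaCoeff_neg, neg_mul]
  simp only [expo]
  congr 3
  push_cast
  ring

lemma expo_diag (τ v u : ℂ) (x y : ℝ) : expo τ (v + u) 0 x y 0 = expo τ v u x y y := by
  simp only [expo]; congr 1; push_cast; ring

lemma neg_I_mul_eta_div_vartheta11 {τ v u : ℂ} (hτ : 0 < τ.im)
    (hw : ∀ n : ℤ, expo τ v u (2 * n) 1 1 ≠ 1) :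
    -I * ModularForm.eta (2 * τ) ^ 3 / vartheta11 (2 * τ) (v + u) = poleSum τ v u := by
  have h1 := vartheta11_mul_tsum hτ (w := v + u) (fun n => by rw [expo_diag]; exact hw n)
  simp only [expo_diag] at h1
  change vartheta11 (2 * τ) (v + u) * poleSum τ v u = _ at h1
  -- Nonvanishing of η makes the product `ϑ₁₁ · poleSum` nonzero, hence ϑ₁₁ itself, so division is
  -- legitimate.
  have h2 : -I * ModularForm.eta (2 * τ) ^ 3 ≠ 0 :=
    mul_ne_zero (neg_ne_zero.mpr Complex.I_ne_zero)
      (pow_ne_zero _ (ModularForm.eta_ne_zero (two_mul_mem_upperHalfPlaneSet hτ)))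
  rw [← h1] at h2 ⊢
  rw [mul_div_cancel_left₀ _ (left_ne_zero_of_mul h2)]

lemma expo_ne_one {τ v u z : ℂ} (hvu : v + u = z)
    (hz : ∀ a b : ℤ, z ≠ (a : ℂ) + (b : ℂ) * (2 * τ)) (n : ℤ) : expo τ v u (2 * n) 1 1 ≠ 1 := by
  intro h
  rw [expo, Complex.exp_eq_one_iff] at h
  obtain ⟨a, ha⟩ := h
  apply hz a (-n)
  have h2 : (2 * π * I : ℂ) ≠ 0 := Complex.two_pi_I_ne_zero
  rw [mul_comm (a : ℂ)] at ha
  have h3 := mul_left_cancel₀ h2 ha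
  rw [← hvu, ← h3]
  push_cast
  ring

/-- The product of `θ⁽⁻⁾` and `Φ^[N/2,0]` in terms of the coefficients of the indefinite theta
series. -/
theorem thetaT_mul_appell_sub_appell {h : ℕ} {τ v u : ℂ} (hτ : 0 < τ.im)
    (hw : ∀ n : ℤ, expo τ v u (2 * n) 1 1 ≠ 1) (hw' : ∀ n : ℤ, expo τ v (-u) (2 * n) 1 1 ≠ 1) :
    thetaT h τ v u * (appell h τ v u - appell h τ v (-u)) =
      thetaB h τ v u * poleSum τ v u - thetaB h τ v (-u) * poleSum τ v (-u) +
      ∑ k ∈ Finset.range (h + 1), oddCoeff h τ v k * (thetaSum h τ u k - thetaSum h τ u (-k)) := by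
  have h1 := thetaT_mul_appell_sub (h := h) hτ hw
  have h2 := thetaT_mul_appell_sub (h := h) hτ hw'
  have h3 : thetaT h τ v (-u) = thetaT h τ v u := by simp [thetaT, expo]
  rw [h3] at h2
  rw [← tsum_tripleTerm_sub h hτ, ← h1, ← h2]
  ring

lemma sum_filter_even (h : ℕ) (f : ℕ → ℂ) :
    ∑ k ∈ (Finset.range (2 * h + 1)).filter Even, f k = ∑ k ∈ Finset.range (h + 1), f (2 * k) := by
  refine (Finset.sum_bij (fun k _ => 2 * k) (fun k hk => ?_) (fun a _ b _ hab => by omega)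
    (fun k hk => ?_) fun k _ => rfl).symm
  · rw [Finset.mem_range] at hk
    rw [Finset.mem_filter, Finset.mem_range]
    exact ⟨by omega, even_two_mul k⟩
  · rw [Finset.mem_filter, Finset.mem_range] at hk
    obtain ⟨hk1, c, rfl⟩ := hk
    exact ⟨c, by rw [Finset.mem_range]; omega, by ring⟩

lemma hasSum_lowerSum (h : ℕ) {τ : ℂ} (hτ : 0 < τ.im) (v : ℂ) (K : ℤ) :
    HasSum (fun j : {j : ℕ // 1 ≤ j} => ∑ r ∈ Finset.range j,
      coeffTerm h τ v (-(j : ℕ)) ((2 * h + 1) * (r - (j : ℕ) + 1) + K)) (lowerSum h τ v K) :=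
  hasSum_lower (G := fun p r => coeffTerm h τ v p ((2 * h + 1) * r + K)) (summable_lower h hτ v K)

lemma hasSum_upperSum (h : ℕ) {τ : ℂ} (hτ : 0 < τ.im) (v : ℂ) (K : ℤ) :
    HasSum (fun j : {j : ℕ // 1 ≤ j} => ∑ r ∈ Finset.range j,
      coeffTerm h τ v (j : ℕ) ((2 * h + 1) * ((j : ℕ) - r) + K)) (upperSum h τ v K) :=
  hasSum_upper (G := fun p r => coeffTerm h τ v p ((2 * h + 1) * r + K)) (summable_upper h hτ v K)

lemma hasSum_lower_add_upper (h : ℕ) {τ : ℂ} (hτ : 0 < τ.im) (v : ℂ) (K K' : ℕ → ℤ)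
    (c : ℕ → ℂ) (s : Finset ℕ) :
    HasSum (fun j : {j : ℕ // 1 ≤ j} => ∑ r ∈ Finset.range j, ∑ k ∈ s,
      (coeffTerm h τ v (-(j : ℕ)) ((2 * h + 1) * (r - (j : ℕ) + 1) + K k) +
        coeffTerm h τ v (j : ℕ) ((2 * h + 1) * ((j : ℕ) - r) + K' k)) * c k)
      (∑ k ∈ s, (lowerSum h τ v (K k) + upperSum h τ v (K' k)) * c k) := by
  refine hasSum_of_eq (hasSum_sum fun k _ => ((hasSum_lowerSum h hτ v (K k)).add
    (hasSum_upperSum h hτ v (K' k))).mul_right (c k)) (fun j => ?_) rfl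
  rw [Finset.sum_comm]
  refine Finset.sum_congr rfl fun k _ => ?_
  rw [← Finset.sum_add_distrib, Finset.sum_mul]

lemma sum_Icc_one (n : ℕ) (f : ℕ → ℂ) :
    ∑ r ∈ Finset.Icc 1 n, f r = ∑ r ∈ Finset.range n, f (r + 1) := by
  rw [Finset.range_eq_Ico, Finset.sum_Ico_add' f 0 n 1]
  rfl

/-- The reflection `(p, l) ↦ (-p, N - l)` negates `y = N - 2l` and the `v`-exponent. The two
exponentials in braces are therefore the lower-sector term at `p = -j` and the upper-sector term at
`p = j`. -/
lemma summand_eq (h : ℕ) (τ v : ℂ) (j : ℕ) (l l' : ℤ) {m X y : ℝ} {X' : ℂ}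
    (hm : m = (2 * h + 1) / 2) (hl : l' = (2 * h + 1) - l)
    (hX : X = 2 * (l - (2 * h + 1) * (-j + 1 / 2))) (hX' : X' = X)
    (hy : y = (2 * h + 1) - 2 * l) :
    (-1 : ℂ) ^ j * qPow τ ((2 * m + 1) * (j : ℝ) ^ 2 - 1 / (8 * m) * y ^ 2) *
      (Complex.exp (π * I * X' * v) * qPow τ (-(1 / 2) * X) +
        Complex.exp (-π * I * X' * v) * qPow τ (1 / 2 * X)) =
    coeffTerm h τ v (-j) l + coeffTerm h τ v j l' := by
  have hN := natCast_two_mul_add_one_ne_zero h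
  subst hm hl hX' hX hy
  rw [coeffTerm, coeffTerm, neg_one_zpow_neg, zpow_natCast, mul_assoc, mul_add, mul_add]
  congr 2
  all_goals
    rw [expo, qPow, qPow, ← Complex.exp_add, ← Complex.exp_add]
    congr 1
    push_cast
    field_simp
    ring

end MockTheta

end


/-! ### Assembly -/

open MockTheta in
theorem mainTheorem3 (N : ℕ) (hN : Odd N) (m : ℝ) (hm : m = (N : ℝ) / 2)
    (τ z₁ z₂ : ℂ) (hτ : 0 < τ.im)
    (hz₁ : ∀ a b : ℤ, 2 * z₁ ≠ (a : ℂ) + (b : ℂ) * (2 * τ))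
    (hz₂ : ∀ a b : ℤ, 2 * z₂ ≠ (a : ℂ) + (b : ℂ) * (2 * τ)) :
    ∃ S₁ S₂ : ℂ,
      HasSum (fun j : {j : ℕ // 1 ≤ j} =>
        ∑ r ∈ Finset.Icc 1 (j : ℕ), ∑ k ∈ (Finset.range N).filter Even,
          (-1 : ℂ) ^ (j : ℕ) *
          MockTheta.qPow τ ((2 * m + 1) * (j : ℝ) ^ 2 -
            1 / (8 * m) * (4 * m * ((j : ℝ) - (r : ℝ)) + 2 * m - (k : ℝ)) ^ 2) *
          (Complex.exp (π * I * (4 * (m : ℂ) * r - 2 * m + k) * (z₁ - z₂)) *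
              MockTheta.qPow τ (-(1 / 2) * (4 * m * (r : ℝ) - 2 * m + (k : ℝ))) +
            Complex.exp (-π * I * (4 * (m : ℂ) * r - 2 * m + k) * (z₁ - z₂)) *
              MockTheta.qPow τ (1 / 2 * (4 * m * (r : ℝ) - 2 * m + (k : ℝ)))) *
          (MockTheta.theta (k : ℝ) (2 * m) τ (z₁ + z₂) -
            MockTheta.theta (-(k : ℝ)) (2 * m) τ (z₁ + z₂))) S₁ ∧
      HasSum (fun j : {j : ℕ // 1 ≤ j} =>
        ∑ r ∈ Finset.range (j : ℕ), ∑ k ∈ (Finset.range N).filter Even,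
          (-1 : ℂ) ^ (j : ℕ) *
          MockTheta.qPow τ ((2 * m + 1) * (j : ℝ) ^ 2 -
            1 / (8 * m) * (4 * m * ((j : ℝ) - (r : ℝ)) - 2 * m + (k : ℝ)) ^ 2) *
          (Complex.exp (π * I * (4 * (m : ℂ) * r + 2 * m - k) * (z₁ - z₂)) *
              MockTheta.qPow τ (-(1 / 2) * (4 * m * (r : ℝ) + 2 * m - (k : ℝ))) +
            Complex.exp (-π * I * (4 * (m : ℂ) * r + 2 * m - k) * (z₁ - z₂)) *
              MockTheta.qPow τ (1 / 2 * (4 * m * (r : ℝ) + 2 * m - (k : ℝ)))) *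
          (MockTheta.theta (k : ℝ) (2 * m) τ (z₁ + z₂) -
            MockTheta.theta (-(k : ℝ)) (2 * m) τ (z₁ + z₂))) S₂ ∧
      MockTheta.thetaMinus (-(2 * m)) (2 * m + 1) τ (2 * m * (z₁ - z₂) / (2 * m + 1)) *
          MockTheta.Phi m 0 (2 * τ) (2 * z₁) (2 * z₂) 0 =
        -I * ModularForm.eta (2 * τ) ^ 3 *
            (MockTheta.thetaMinus (2 * m) (2 * m + 1) τ
                ((z₁ - z₂) / (2 * m + 1) + z₁ + z₂) /
                MockTheta.vartheta11 (2 * τ) (2 * z₁) +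
              MockTheta.thetaMinus (2 * m) (2 * m + 1) τ
                ((z₁ - z₂) / (2 * m + 1) - z₁ - z₂) /
                MockTheta.vartheta11 (2 * τ) (2 * z₂)) -
          MockTheta.qPow τ (-(m / (2 * (2 * m + 1)))) *
            Complex.exp (2 * π * I * m / (2 * m + 1) * (z₁ - z₂)) * S₁ +
          MockTheta.qPow τ (-(m / (2 * (2 * m + 1)))) *
            Complex.exp (2 * π * I * m / (2 * m + 1) * (z₁ - z₂)) * S₂ +
          MockTheta.thetaMinus (-(2 * m)) (2 * m + 1) τ (2 * m * (z₁ - z₂) / (2 * m + 1)) *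
            ∑ k ∈ Finset.Icc 1 ((N - 1) / 2),
              Complex.exp (2 * π * I * k * (z₁ - z₂)) *
                MockTheta.qPow τ (-((k : ℝ) ^ 2 / (2 * m))) *
                (MockTheta.theta (k : ℝ) m (2 * τ) (2 * z₁ + 2 * z₂) -
                  MockTheta.theta (-(k : ℝ)) m (2 * τ) (2 * z₁ + 2 * z₂)) := by
  obtain ⟨h, rfl⟩ := hN
  have hm' : m = (2 * h + 1) / 2 := by rw [hm]; push_cast; ring
  clear hm
  have hMC := natCast_two_mul_add_two_ne_zero h
  have h2m : 2 * m = 2 * h + 1 := by rw [hm']; ring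
  have h2mC : 2 * (m : ℂ) = 2 * h + 1 := by exact_mod_cast h2m
  have h2mM : 2 * m + 1 = 2 * h + 2 := by rw [h2m]; ring
  have h2mMC : 2 * (m : ℂ) + 1 = 2 * h + 2 := by rw [h2mC]; ring
  set v := z₁ - z₂ with hv
  set u := z₁ + z₂ with hu
  have hΘ (k : ℕ) : theta ((2 * k : ℕ) : ℝ) (2 * m) τ u -
      theta (-((2 * k : ℕ) : ℝ)) (2 * m) τ u =
      thetaSum h τ u k - thetaSum h τ u (-k) := by
    rw [← theta_two_mul_index, ← theta_two_mul_index, h2m]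
    push_cast
    rw [mul_neg]
  have hΘ' (k : ℕ) : theta (k : ℝ) m (2 * τ) (2 * z₁ + 2 * z₂) -
      theta (-(k : ℝ)) m (2 * τ) (2 * z₁ + 2 * z₂) =
      thetaSum h τ u k - thetaSum h τ u (-k) := by
    rw [← theta_two_mul_period, ← theta_two_mul_period, ← mul_add, hm']
    push_cast
    rfl
  -- The first double sum pairs the lower sector at `k` with the upper at `-k`, the second does the
  -- opposite; here `k` is half the even index of the statement.
  have hS₁ := hasSum_lower_add_upper h hτ v (fun k => k) (fun k => -k)
    (fun k => thetaSum h τ u k - thetaSum h τ u (-k)) (Finset.range (h + 1))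
  have hS₂ := hasSum_lower_add_upper h hτ v (fun k => -k) (fun k => k)
    (fun k => thetaSum h τ u k - thetaSum h τ u (-k)) (Finset.range (h + 1))
  refine ⟨_, _, hasSum_of_eq hS₁ (fun j => ?_) rfl,
    hasSum_of_eq hS₂ (fun j => ?_) rfl, ?_⟩
  · rw [sum_Icc_one]
    refine Finset.sum_congr rfl fun s _ => ?_
    rw [sum_filter_even]
    refine Finset.sum_congr rfl fun k _ => congrArg₂ (· * ·)
      (summand_eq h τ v j _ _ hm' (by ring) ?_ ?_ ?_) (hΘ k)
    · push_cast; rw [hm']; ring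
    · push_cast; ring
    · push_cast; rw [hm']; ring
  · refine Finset.sum_congr rfl fun s _ => ?_
    rw [sum_filter_even]
    refine Finset.sum_congr rfl fun k _ => congrArg₂ (· * ·)
      (summand_eq h τ v j _ _ hm' (by ring) ?_ ?_ ?_) (hΘ k)
    · push_cast; rw [hm']; ring
    · push_cast; ring
    · push_cast; rw [hm']; ring
  · have hw₁ := expo_ne_one (v := v) (u := u) (by rw [hv, hu]; ring) hz₁
    have hw₂ := expo_ne_one (τ := τ) (v := v) (u := -u) (z := -(2 * z₂))
      (by rw [hv, hu]; ring) fun a b hab => hz₂ (-a) (-b) (by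
        push_cast; linear_combination -hab)
    have key := thetaT_mul_appell_sub_appell (h := h) hτ hw₁ hw₂
    have e₁ := neg_I_mul_eta_div_vartheta11 hτ hw₁
    have e₂ := neg_I_mul_eta_div_vartheta11 hτ hw₂
    rw [show v + u = 2 * z₁ by rw [hv, hu]; ring] at e₁
    -- Oddness of ϑ₁₁ turns the difference of the two quotients into the sum in the statement.
    rw [show v + -u = -(2 * z₂) by rw [hv, hu]; ring, vartheta11_neg] at e₂
    have hP : qPow τ (-(m / (2 * (2 * m + 1)))) *
        Complex.exp (2 * π * I * m / (2 * m + 1) * v) =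
        expo τ v 0 (-((2 * h + 1) / (4 * (2 * h + 2))))
          ((2 * h + 1) / (2 * (2 * h + 2))) 0 := by
      rw [qPow, expo, ← Complex.exp_add, h2mM, h2mMC, hm']
      congr 1
      push_cast
      field_simp
      ring
    have hT := thetaMinus_neg_eq h τ v u
    have hB₁ := thetaMinus_eq h τ v u
    have hB₂ := thetaMinus_eq h τ v (-u)
    have hΦ := Phi_eq_appell_sub h τ z₁ z₂
    rw [← hm'] at hΦ
    rw [hP, h2mM, h2m, h2mMC, h2mC, hT, hΦ, add_assoc (v / _), hB₁, sub_sub, sub_eq_add_neg (v / _),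
      hB₂]
    have hlast : ∑ k ∈ Finset.Icc 1 ((2 * h + 1 - 1) / 2),
        Complex.exp (2 * π * I * k * v) * qPow τ (-((k : ℝ) ^ 2 / (2 * h + 1))) *
          (theta (k : ℝ) m (2 * τ) (2 * z₁ + 2 * z₂) -
            theta (-(k : ℝ)) m (2 * τ) (2 * z₁ + 2 * z₂)) =
        ∑ k ∈ Finset.range (h + 1), expo τ v u (-((k : ℝ) ^ 2 / (2 * h + 1))) k 0 *
          (thetaSum h τ u k - thetaSum h τ u (-k)) := by
      rw [show (2 * h + 1 - 1) / 2 = h by omega, sum_Icc_one, Finset.sum_range_succ']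
      simp only [hΘ', Nat.cast_zero, neg_zero, sub_self, mul_zero, add_zero]
      refine Finset.sum_congr rfl fun k _ => ?_
      rw [expo, qPow, ← Complex.exp_add]
      congr 2
      push_cast
      ring
    have hodd : ∑ k ∈ Finset.range (h + 1), oddCoeff h τ v k *
        (thetaSum h τ u k - thetaSum h τ u (-k)) =
        thetaT h τ v u * (∑ k ∈ Finset.range (h + 1),
          expo τ v u (-((k : ℝ) ^ 2 / (2 * h + 1))) k 0 *
            (thetaSum h τ u k - thetaSum h τ u (-k))) +
        (∑ k ∈ Finset.range (h + 1), (lowerSum h τ v (-k) + upperSum h τ v k) *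
          (thetaSum h τ u k - thetaSum h τ u (-k))) -
        ∑ k ∈ Finset.range (h + 1), (lowerSum h τ v k + upperSum h τ v (-k)) *
          (thetaSum h τ u k - thetaSum h τ u (-k)) := by
      rw [Finset.mul_sum, ← Finset.sum_add_distrib, ← Finset.sum_sub_distrib]
      refine Finset.sum_congr rfl fun k hk => ?_
      -- At `k = 0` the theta difference vanishes, so the coefficient formula is needed only for `k
      -- > 0`.
      rcases Nat.eq_zero_or_pos k with rfl | hk0
      · simp
      · rw [Finset.mem_range] at hk
        rw [oddCoeff_eq hτ v u (by exact_mod_cast hk0) (by omega), Int.cast_natCast]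
        ring
    rw [hlast]
    rw [hodd, ← e₁, ← e₂] at key
    linear_combination expo τ v 0 (-((2 * h + 1) / (4 * (2 * h + 2))))
      ((2 * h + 1) / (2 * (2 * h + 2))) 0 * key
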